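/- **Setting.** Let $D\subseteq\mathbb R^d$. A $k$-simplex in $D$ is a tuple $S=[p_0\dots p_k]$ with $\operatorname{conv}\{p_0,\dots,p_k\}\subseteq D$; a $k$-germ in $D$ is a real function $\omega$ of the $k$-simplices in $D$ (so a $0$-germ is a function on $D$). Put $(\delta\omega)_{p_0\dots p_{k+1}}=\sum_{i=0}^{k+1}(-1)^i\omega_{p_0\dots\hat p_i\dots p_{k+1}}$, and $(f\cup\omega)_{p_0\dots p_k}=f(p_0)\,\omega_{p_0\dots p_k}$ for a $0$-germ $f$. For a $0$-germ $f$ and $\alpha>0$ let $[\delta f]_\alpha\in[0,\infty]$ be the least $c$ with $|f(q)-f(p)|\le c|q-p|^\alpha$ for all $1$-simplices $[pq]$ in $D$. A $k$-germ is *regular* if it vanishes on simplices of zero $k$-volume and its pull-back by every affine map from a subset of $\mathbb R^k$ to $D$ is $\delta$-closed. A *$k$-Dini gauge* is a $k$-germ $v\ge 0$ that takes equal values on isometric simplices and satisfies $2^{nk}v(2^{-n}S)\to0$ as $n\to\infty$ for every $k$-simplex $S$ in $D$ (here $v(2^{-n}S)$ is the value of $v$ at any translate of $2^{-n}S$ in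 $D$). A $k$-germ $\omega$ is *sewable* if there are a regular $k$-germ, denoted $\operatorname{sew}\omega$, a $k$-Dini gauge $v$ and a constant $c$ with $|\omega-\operatorname{sew}\omega|\le c\,v$ (for $k=1,2$ such a regular germ is unique). For $0$-germs put $g^1\,\mathrm dg^2:=\operatorname{sew}(g^1\cup\delta g^2)$ and $f\,\mathrm dg^1\wedge \mathrm dg^2:=\operatorname{sew}\bigl(f\cup\delta(g^1\,\mathrm dg^2)\bigr)$; the latter is called *defined* if both germs to be sewn are sewable. **Proposition (chain rule for Züst integrals).** Let $\alpha>0$, $\beta>0$, $\sigma\in(0,1]$ with $\min\{\alpha,\sigma\beta\}+2\beta>2$. Let $f\colon D\to\mathbb R$ and $g=(g^1,\dots,g^\ell)\colon D\to\mathbb R^\ell$ be bounded with $[\delta f]_\alpha<\infty$ and $[\delta g^i]_\beta<\infty$ for all $i$, and let $\Psi=(\Psi^1,\Psi^2)\colon\mathbb R^\ell\to\mathbb R^2$ be $C^{1,\sigma}$, i.e. $C^1$ with all partial derivatives $\partial_i\Psi^m$ globally $\sigma$-Hölder on $\mathbb R^\ell$. Then $f\,\mathrm d(\Psi^1\circ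 g)\wedge \mathrm d(\Psi^2\circ g)$ and, for all $i<j$, $(f\,J^{ij}_\Psi\circ g)\,\mathrm dg^i\wedge \mathrm dg^j$ are defined, and, as $2$-germs in $D$, \[ f\,\mathrm d(\Psi^1\circ g)\wedge \mathrm d(\Psi^2\circ g)=\sum_{1\le i<j\le\ell}(f\,J^{ij}_\Psi\circ g)\,\mathrm dg^i\wedge \mathrm dg^j,\qquad J^{ij}_\Psi=\det\begin{pmatrix}\partial_i\Psi^1&\partial_j\Psi^1\\ \partial_i\Psi^2&\partial_j\Psi^2\end{pmatrix}. \] -/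

import Mathlib

noncomputable section

namespace RoughForm

/-- `ℝᵈ` with its Euclidean norm. -/
abbrev E (d : ℕ) : Type := EuclideanSpace ℝ (Fin d)

/-- A `k`-simplex in `D`: an ordered tuple `[p₀ … pₖ]` whose convex envelope lies in `D`. -/
def Simp {d : ℕ} (k : ℕ) (D : Set (E d)) : Type :=
  {p : Fin (k + 1) → E d // convexHull ℝ (Set.range p) ⊆ D}

namespace Simp

variable {d k h : ℕ} {D : Set (E d)}

/-- The tuple obtained from a simplex by selecting vertices. -/
def select (S : Simp k D) (e : Fin (h + 1) → Fin (k + 1)) : Simp h D :=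
  ⟨S.1 ∘ e, (convexHull_mono (Set.range_comp_subset_range e S.1)).trans S.2⟩

/-- The `i`-th vertex, as a `0`-simplex `[pᵢ]`. -/
def vertex (S : Simp k D) (i : Fin (k + 1)) : Simp 0 D :=
  S.select fun _ => i

/-- The `i`-th face `[p₀ … p̂ᵢ … pₖ₊₁]`. -/
def face (S : Simp (k + 1) D) (i : Fin (k + 2)) : Simp k D :=
  S.select i.succAbove

/-- The push-forward `[φ(p₀) … φ(pₖ)]` of a simplex under an affine map that maps `I` to `D`. -/
def map {n : ℕ} {I : Set (E n)} (φ : E n →ᵃ[ℝ] E d) (hφ : Set.MapsTo φ I D) (S : Simp k I) :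
    Simp k D :=
  ⟨φ ∘ S.1, by
    rw [Set.range_comp, ← AffineMap.image_convexHull]
    rintro _ ⟨x, hx, rfl⟩
    exact hφ (S.2 hx)⟩

/-- The copy of `2⁻ⁿ S` in `D` with the same base point: its vertices are
`p₀ + 2⁻ⁿ (pⱼ - p₀)`, so it is a translate of the simplex `[2⁻ⁿp₀ … 2⁻ⁿpₖ]`. -/
def shrink (S : Simp k D) (n : ℕ) : Simp k D :=
  ⟨fun j => S.1 0 + ((2 : ℝ)⁻¹ ^ n) • (S.1 j - S.1 0), by
    refine (convexHull_min ?_ (convex_convexHull ℝ (Set.range S.1))).trans S.2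
    rintro _ ⟨j, rfl⟩
    exact (convex_convexHull ℝ (Set.range S.1)).add_smul_sub_mem
      (subset_convexHull ℝ _ ⟨0, rfl⟩) (subset_convexHull ℝ _ ⟨j, rfl⟩)
      ⟨by positivity, pow_le_one₀ (by norm_num) (by norm_num)⟩⟩

/-- Two simplices are isometric if an isometry of `ℝᵈ` maps one to the other, vertex by vertex. -/
def Isometric (S T : Simp k D) : Prop :=
  ∃ ι : E d → E d, Isometry ι ∧ ∀ j, ι (S.1 j) = T.1 j

/-- The diameter of a simplex, `maxᵢⱼ |pᵢ - pⱼ|`. -/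
def diam (S : Simp k D) : ℝ := Metric.diam (Set.range S.1)

/-- The `k`-volume `(1 / k!) √ det (P Pᵀ)`, where the rows of `P` are `pᵢ - p₀`, `i = 1, …, k`. -/
def vol (S : Simp k D) : ℝ :=
  let P : Matrix (Fin k) (Fin d) ℝ := Matrix.of fun i j => S.1 i.succ j - S.1 0 j
  1 / (k.factorial : ℝ) * Real.sqrt (P * P.transpose).det

end Simp

/-- A `k`-germ in `D`: a real function of `k`-simplices.  A `0`-germ is a function on `D`. -/
abbrev Germ {d : ℕ} (k : ℕ) (D : Set (E d)) : Type := Simp k D → ℝ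

namespace Germ

variable {d k : ℕ} {D : Set (E d)}

/-- The discrete exterior derivative, dual to the boundary of simplices. -/
def delta (ω : Germ k D) : Germ (k + 1) D :=
  fun S => ∑ i : Fin (k + 2), (-1 : ℝ) ^ (i : ℕ) * ω (S.face i)

/-- The cup product `f ∪ ω` of a `0`-germ and a `k`-germ. -/
def cup (f : Germ 0 D) (ω : Germ k D) : Germ k D :=
  fun S => f (S.vertex 0) * ω S

/-- The composition `F ∘ (ω¹, …, ωⁿ)`. -/
def comp {n : ℕ} (F : E n → ℝ) (ω : Fin n → Germ k D) : Germ k D :=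
  fun S => F (WithLp.toLp 2 fun i => ω i S)

/-- The pull-back of a germ by an affine map. -/
def pullback {n : ℕ} {I : Set (E n)} (φ : E n →ᵃ[ℝ] E d) (hφ : Set.MapsTo φ I D)
    (ω : Germ k D) : Germ k I :=
  fun S => ω (S.map φ hφ)

/-- `[ω]_v < ∞`: there is a constant `c` with `|ω_S| ≤ c v_S` for every simplex `S` in `D`. -/
def BoundedBy (ω v : Germ k D) : Prop :=
  ∃ c : ℝ, ∀ S, |ω S| ≤ c * v S

/-- `ω ≈_v ω'`, that is `[ω - ω']_v < ∞`. -/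
def Near (v ω ω' : Germ k D) : Prop :=
  BoundedBy (ω - ω') v

/-- `[δf]_α < ∞` for a `0`-germ `f`, that is `|f(q) - f(p)| ≤ c |q - p|^α` for all segments
`[p q]` in `D`. -/
def Holder (α : ℝ) (f : Germ 0 D) : Prop :=
  BoundedBy (delta f) fun S => S.diam ^ α

/-- The sup norm of a germ is finite. -/
def Bounded (f : Germ k D) : Prop :=
  ∃ M : ℝ, ∀ S, |f S| ≤ M

/-- A gauge (nonnegative germ) that is uniform (equal on isometric simplices) and `r`-Dini:
`2^{nr} u(2⁻ⁿ S) → 0` for every simplex `S`. -/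
structure IsDini (r : ℝ) (u : Germ k D) : Prop where
  nonneg : ∀ S, 0 ≤ u S
  uniform : ∀ S T : Simp k D, S.Isometric T → u S = u T
  tendsto : ∀ S : Simp k D,
    Filter.Tendsto (fun n : ℕ => (2 : ℝ) ^ ((n : ℝ) * r) * u (S.shrink n)) Filter.atTop (nhds 0)

/-- Regular germs: nonatomic, and closed on `k`-planes. -/
structure IsRegular (ω : Germ k D) : Prop where
  nonatomic : ∀ S : Simp k D, S.vol = 0 → ω S = 0
  closed : ∀ (I : Set (E k)) (φ : E k →ᵃ[ℝ] E d) (hφ : Set.MapsTo φ I D),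
    delta (pullback φ hφ ω) = 0

/-- `η` is a regular germ that is near `ω` with respect to some `k`-Dini gauge. -/
def IsSew (ω η : Germ k D) : Prop :=
  IsRegular η ∧ ∃ v : Germ k D, IsDini (k : ℝ) v ∧ Near v ω η

/-- Sewable germs. -/
def Sewable (ω : Germ k D) : Prop :=
  ∃ η : Germ k D, IsSew ω η

open Classical in
/-- The regular germ `sew ω` of a sewable germ (zero if `ω` is not sewable). -/
def sew (ω : Germ k D) : Germ k D :=
  if h : Sewable ω then h.choose else 0

/-- `f dη := sew (f ∪ δη)`.  For a `0`-germ `η` this is the Young germ. -/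
def integ (f : Germ 0 D) (η : Germ k D) : Germ (k + 1) D :=
  sew (cup f (delta η))

/-- `f dη` is defined: the germ `f ∪ δη` is sewable. -/
def Integrable (f : Germ 0 D) (η : Germ k D) : Prop :=
  Sewable (cup f (delta η))

/-- The Züst germ `f dg¹ ∧ dg² := f d(g¹ dg²)`. -/
def wedge (f g₁ g₂ : Germ 0 D) : Germ 2 D :=
  integ f (integ g₁ g₂)

/-- `f dg¹ ∧ dg²` is defined: the Young germ `g¹ dg²` and the germ `f d(g¹ dg²)` both are. -/
def WedgeIntegrable (f g₁ g₂ : Germ 0 D) : Prop :=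
  Integrable g₁ g₂ ∧ Integrable f (integ g₁ g₂)

end Germ

/-- The partial derivative `∂ᵢ Ψᵐ`. -/
def partialDeriv {l n : ℕ} (Ψ : E l → E n) (m : Fin n) (i : Fin l) (x : E l) : ℝ :=
  fderiv ℝ (fun y => Ψ y m) x (EuclideanSpace.single i 1)

/-- `Ψ` is `C^{1,σ}`: it is `C¹` and its partial derivatives are `σ`-Hölder on `ℝˡ`. -/
def IsC1Holder {l n : ℕ} (σ : ℝ) (Ψ : E l → E n) : Prop :=
  ContDiff ℝ 1 Ψ ∧ ∀ (m : Fin n) (i : Fin l), ∃ c : ℝ, ∀ x y : E l,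
    |partialDeriv Ψ m i y - partialDeriv Ψ m i x| ≤ c * ‖y - x‖ ^ σ

/-- The Jacobian minor `J^{ij}_Ψ`. -/
def jacobianMinor {l : ℕ} (Ψ : E l → E 2) (i j : Fin l) (x : E l) : ℝ :=
  Matrix.det !![partialDeriv Ψ 0 i x, partialDeriv Ψ 0 j x;
                partialDeriv Ψ 1 i x, partialDeriv Ψ 1 j x]

end RoughForm

end

/-! Everything rests on dyadic sewing. Replace a function `a` of cells by its sums over iterated
subdivisions. If a cell of size s has N children of size at most s/2, and one subdivision changes
`a` by O(s^γ) with N < 2^γ, these sums converge geometrically, and any subdivision-invariant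
function within O(s^γ) of `a` equals the limit (`sewLim_eq`). The limit is also stable under
pointwise convergence with uniform constants (`tendsto_sewLim_of_tendsto`). Segments (N = 2) give
Young germs, with defect of order 2β > 1; triangles (N = 4) give Züst germs, with defect of order α
+ 2β > 2.

These limits must then be recognized as the germs `sew`. Dyadic invariance alone is weaker than
regularity, which asks for closedness on all simplices in a line or plane. For smooth functions
closedness holds because the germ is exact: f dg = dA on a line with A' = f g', and f dg ∧ dh = d(A
dy) on a plane with ∂ₓA equal to f times the Jacobian of (g, h). Mollification with uniform Hölder
constants carries this over to Hölder functions. Conversely, a regular 1- or 2-germ is invariant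
under dyadic subdivision, so one dominated by a Dini gauge vanishes (`eq_zero_of_isDini`). Sewings
are therefore unique, and the germ picked by choice in `sew` is the constructed one.

The chain rule is then a local comparison. On a triangle with first vertex p, replace Ψ ∘ g by its
linear part dΨ(g(p)) g; the remainder has β-Hölder constant O(diam^{σβ}) there. Since Young germs
are bilinear and δ(gⁱ dgʲ) is antisymmetric in i and j, `bdry_young_linearize` gives δ((Ψ¹∘g)
d(Ψ²∘g)) = ∑_{i<j} J^{ij}(g(p)) δ(gⁱ dgʲ) + O(diam^{σβ+2β}). Multiplied by f(p), the main term is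
exactly the sum of the germs to be sewn on the right-hand side. The error is a 2-Dini gauge because
σβ + 2β > 2, so uniqueness of sewings gives the identity. -/

namespace RoughForm

open Filter Topology

/-! ### Abstract dyadic sewing -/

section Sewing

variable {X ι : Type*} [Fintype ι] (ch : ι → X → X)

/-- The sum of `a` over the children of a cell. -/
def refine (a : X → ℝ) : X → ℝ := fun x => ∑ i, a (ch i x)

/-- The limit of the sums of `a` over iterated subdivisions. -/
noncomputable def sewLim (a : X → ℝ) : X → ℝ :=
  fun x => limUnder atTop fun n => (refine ch)^[n] a x

/-- The children of a cell in `P` are in `P` and at most half as big. -/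
structure Halving (P : X → Prop) (s : X → ℝ) : Prop where
  nonneg : ∀ x, 0 ≤ s x
  mem : ∀ i x, P x → P (ch i x)
  le : ∀ i x, P x → s (ch i x) ≤ s x / 2

variable {ch} {P : X → Prop} {s : X → ℝ} {a b : X → ℝ} {C γ : ℝ}

lemma refine_iterate_add (a b : X → ℝ) (n : ℕ) :
    (refine ch)^[n] (a + b) = (refine ch)^[n] a + (refine ch)^[n] b := by
  induction n generalizing a b with
  | zero => rfl
  | succ n ih =>
    simp only [Function.iterate_succ, Function.comp]
    rw [← ih]
    congr 1
    funext x
    simp [refine, Finset.sum_add_distrib]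

lemma refine_iterate_smul (c : ℝ) (a : X → ℝ) (n : ℕ) :
    (refine ch)^[n] (c • a) = c • (refine ch)^[n] a := by
  induction n generalizing a with
  | zero => rfl
  | succ n ih =>
    simp only [Function.iterate_succ, Function.comp]
    rw [← ih]
    congr 1
    funext x
    simp [refine, Finset.mul_sum]

lemma refine_iterate_sub (a b : X → ℝ) (n : ℕ) :
    (refine ch)^[n] (a - b) = (refine ch)^[n] a - (refine ch)^[n] b := by
  rw [sub_eq_add_neg, ← neg_one_smul ℝ b, refine_iterate_add, refine_iterate_smul]
  simp [sub_eq_add_neg]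

lemma refine_iterate_congr (hmem : ∀ i x, P x → P (ch i x)) (hab : ∀ x, P x → a x = b x) (n : ℕ) :
    ∀ x, P x → (refine ch)^[n] a x = (refine ch)^[n] b x := by
  induction n generalizing a b with
  | zero => exact hab
  | succ n ih =>
    exact ih fun x hx => Finset.sum_congr rfl fun i _ => hab _ (hmem i x hx)

/-- Each subdivision multiplies the number of cells by N = `Fintype.card ι` and the bound on each
cell by 2^{-γ}, hence the ratio N / 2^γ. -/
lemma abs_refine_iterate_le (h : Halving ch P s) (hγ : 0 ≤ γ) (hC : 0 ≤ C)
    (hb : ∀ x, P x → |b x| ≤ C * s x ^ γ) (n : ℕ) :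
    ∀ x, P x → |(refine ch)^[n] b x| ≤ (C * s x ^ γ) * (Fintype.card ι / 2 ^ γ) ^ n := by
  induction n with
  | zero => intro x hx; simpa using hb x hx
  | succ n ih =>
    intro x hx
    rw [Function.iterate_succ_apply']
    have hstep : ∀ i, |(refine ch)^[n] b (ch i x)| ≤
        (C * (s x / 2) ^ γ) * (Fintype.card ι / 2 ^ γ) ^ n := by
      intro i
      refine (ih _ (h.mem i x hx)).trans ?_
      have h0 := h.nonneg (ch i x)
      have h1 := h.le i x hx
      gcongr
    calc |refine ch ((refine ch)^[n] b) x|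
        ≤ ∑ i, |(refine ch)^[n] b (ch i x)| := Finset.abs_sum_le_sum_abs _ _
      _ ≤ ∑ _i : ι, (C * (s x / 2) ^ γ) * (Fintype.card ι / 2 ^ γ) ^ n :=
          Finset.sum_le_sum fun i _ => hstep i
      _ = _ := by
          rw [Finset.sum_const, Real.div_rpow (h.nonneg x) (by norm_num), nsmul_eq_mul,
            Finset.card_univ]
          ring

lemma card_div_lt_one (hN : (Fintype.card ι : ℝ) < 2 ^ γ) : (Fintype.card ι : ℝ) / 2 ^ γ < 1 := by
  rw [div_lt_one (by positivity)]
  exact hN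

/-- Iterated refinement fixes `b`, and by linearity it contracts `b - a` geometrically. This is the
uniqueness half of sewing. -/
lemma tendsto_refine_iterate (h : Halving ch P s) (hγ : 0 ≤ γ) (hC : 0 ≤ C)
    (hN : (Fintype.card ι : ℝ) < 2 ^ γ) (hb : ∀ x, P x → refine ch b x = b x)
    (hab : ∀ x, P x → |b x - a x| ≤ C * s x ^ γ) {x : X} (hx : P x) :
    Tendsto (fun n => (refine ch)^[n] a x) atTop (𝓝 (b x)) := by
  have hfix : ∀ n, (refine ch)^[n] b x = b x := by
    intro n
    induction n with
    | zero => rfl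
    | succ n ih =>
      rw [Function.iterate_succ_apply, refine_iterate_congr h.mem hb n x hx, ih]
  rw [tendsto_iff_dist_tendsto_zero]
  have hgeo : Tendsto (fun n : ℕ => (C * s x ^ γ) * (Fintype.card ι / 2 ^ γ) ^ n) atTop (𝓝 0) := by
    simpa using (tendsto_pow_atTop_nhds_zero_of_lt_one (by positivity)
      (card_div_lt_one hN)).const_mul (C * s x ^ γ)
  refine squeeze_zero (fun _ => dist_nonneg) (fun n => ?_) hgeo
  have := abs_refine_iterate_le h hγ hC (b := b - a) hab n x hx
  rw [refine_iterate_sub] at this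
  rw [dist_comm, Real.dist_eq]
  simpa [hfix] using this

lemma sewLim_eq (h : Halving ch P s) (hγ : 0 ≤ γ) (hC : 0 ≤ C)
    (hN : (Fintype.card ι : ℝ) < 2 ^ γ) (hb : ∀ x, P x → refine ch b x = b x)
    (hab : ∀ x, P x → |b x - a x| ≤ C * s x ^ γ) {x : X} (hx : P x) : sewLim ch a x = b x :=
  (tendsto_refine_iterate h hγ hC hN hb hab hx).limUnder_eq

/-- By linearity the difference of consecutive sums is the iterated refinement of the defect `refine
ch a - a`. This gives the existence half of sewing. -/
lemma dist_refine_iterate_succ_le (h : Halving ch P s) (hγ : 0 ≤ γ) (hC : 0 ≤ C)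
    (ha : ∀ x, P x → |refine ch a x - a x| ≤ C * s x ^ γ) {x : X} (hx : P x) (n : ℕ) :
    dist ((refine ch)^[n] a x) ((refine ch)^[n + 1] a x) ≤
      (C * s x ^ γ) * (Fintype.card ι / 2 ^ γ) ^ n := by
  have := abs_refine_iterate_le h hγ hC (b := refine ch a - a) ha n x hx
  rw [refine_iterate_sub] at this
  rw [dist_comm, Real.dist_eq]
  exact this

lemma tendsto_sewLim (h : Halving ch P s) (hγ : 0 ≤ γ) (hC : 0 ≤ C)
    (hN : (Fintype.card ι : ℝ) < 2 ^ γ)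
    (ha : ∀ x, P x → |refine ch a x - a x| ≤ C * s x ^ γ) {x : X} (hx : P x) :
    Tendsto (fun n => (refine ch)^[n] a x) atTop (𝓝 (sewLim ch a x)) :=
  tendsto_nhds_limUnder <| cauchySeq_tendsto_of_complete <|
    cauchySeq_of_le_geometric _ _ (card_div_lt_one hN)
      (dist_refine_iterate_succ_le h hγ hC ha hx)

lemma abs_sewLim_sub_le (h : Halving ch P s) (hγ : 0 ≤ γ) (hC : 0 ≤ C)
    (hN : (Fintype.card ι : ℝ) < 2 ^ γ)
    (ha : ∀ x, P x → |refine ch a x - a x| ≤ C * s x ^ γ) {x : X} (hx : P x) :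
    |sewLim ch a x - a x| ≤ (C * s x ^ γ) / (1 - Fintype.card ι / 2 ^ γ) := by
  have := dist_le_of_le_geometric_of_tendsto₀ _ _ (card_div_lt_one hN)
    (dist_refine_iterate_succ_le h hγ hC ha hx) (tendsto_sewLim h hγ hC hN ha hx)
  rwa [dist_comm, Real.dist_eq] at this

lemma tendsto_refine_iterate_of_tendsto {A : ℕ → X → ℝ} (hmem : ∀ i x, P x → P (ch i x))
    (hA : ∀ x, P x → Tendsto (fun k => A k x) atTop (𝓝 (a x))) (n : ℕ) :
    ∀ x, P x → Tendsto (fun k => (refine ch)^[n] (A k) x) atTop (𝓝 ((refine ch)^[n] a x)) := by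
  induction n with
  | zero => exact hA
  | succ n ih =>
    intro x hx
    simp only [Function.iterate_succ_apply']
    exact tendsto_finsetSum _ fun i _ => ih _ (hmem i x hx)

lemma dist_refine_iterate_sewLim_le (h : Halving ch P s) (hγ : 0 ≤ γ) (hC : 0 ≤ C)
    (hN : (Fintype.card ι : ℝ) < 2 ^ γ)
    (ha : ∀ x, P x → |refine ch a x - a x| ≤ C * s x ^ γ) {x : X} (hx : P x) (n : ℕ) :
    dist ((refine ch)^[n] a x) (sewLim ch a x) ≤
      (C * s x ^ γ) * (Fintype.card ι / 2 ^ γ) ^ n / (1 - Fintype.card ι / 2 ^ γ) :=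
  dist_le_of_le_geometric_of_tendsto _ _ (card_div_lt_one hN)
    (dist_refine_iterate_succ_le h hγ hC ha hx) (tendsto_sewLim h hγ hC hN ha hx) n

/-- The distance from the n-th sum to the limit is bounded uniformly in `k`, while for fixed `n` the
sum is finite and converges in `k`; an ε/3 argument exchanges the limits. -/
lemma tendsto_sewLim_of_tendsto {A : ℕ → X → ℝ} (h : Halving ch P s) (hγ : 0 ≤ γ) (hC : 0 ≤ C)
    (hN : (Fintype.card ι : ℝ) < 2 ^ γ)
    (hAC : ∀ k x, P x → |refine ch (A k) x - A k x| ≤ C * s x ^ γ)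
    (hA : ∀ x, P x → Tendsto (fun k => A k x) atTop (𝓝 (a x))) {x : X} (hx : P x) :
    Tendsto (fun k => sewLim ch (A k) x) atTop (𝓝 (sewLim ch a x)) := by
  have ha : ∀ x, P x → |refine ch a x - a x| ≤ C * s x ^ γ := by
    intro x hx
    have h1 := tendsto_refine_iterate_of_tendsto h.mem hA 1 x hx
    exact le_of_tendsto ((h1.sub (hA x hx)).abs) (Eventually.of_forall fun k => hAC k x hx)
  rw [Metric.tendsto_atTop]
  intro ε hε
  have hgeo : Tendsto (fun n : ℕ => (C * s x ^ γ) * (Fintype.card ι / 2 ^ γ) ^ n /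
      (1 - Fintype.card ι / 2 ^ γ)) atTop (𝓝 0) := by
    simpa using ((tendsto_pow_atTop_nhds_zero_of_lt_one (by positivity)
      (card_div_lt_one hN)).const_mul (C * s x ^ γ)).div_const (1 - Fintype.card ι / 2 ^ γ)
  obtain ⟨n, hn⟩ := (hgeo.eventually_lt_const (show 0 < ε / 3 by positivity)).exists
  obtain ⟨k₀, hk₀⟩ := Metric.tendsto_atTop.1
    (tendsto_refine_iterate_of_tendsto h.mem hA n x hx) (ε / 3) (by positivity)
  refine ⟨k₀, fun k hk => ?_⟩
  have h1 := dist_refine_iterate_sewLim_le h hγ hC hN (hAC k) hx n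
  have h2 := dist_refine_iterate_sewLim_le h hγ hC hN ha hx n
  have h3 := hk₀ k hk
  rw [dist_comm] at h1
  have := dist_triangle4 (sewLim ch (A k) x) ((refine ch)^[n] (A k) x) ((refine ch)^[n] a x)
    (sewLim ch a x)
  linarith

end Sewing

/-! ### Hölder functions on sets and their smooth approximation -/

/-- `f` is `β`-Hölder on `K` with constant `c`. -/
def HolderBound {V : Type*} [PseudoMetricSpace V] (c β : ℝ) (f : V → ℝ) (K : Set V) : Prop :=
  ∀ x ∈ K, ∀ y ∈ K, |f x - f y| ≤ c * dist x y ^ β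

namespace HolderBound

variable {V W : Type*} [PseudoMetricSpace V] [PseudoMetricSpace W] {c c' β : ℝ} {f g : V → ℝ}
  {K L : Set V}

lemma mono (h : HolderBound c β f K) (hL : L ⊆ K) : HolderBound c β f L :=
  fun x hx y hy => h x (hL hx) y (hL hy)

lemma weaken (h : HolderBound c β f K) (hc : c ≤ c') : HolderBound c' β f K := fun x hx y hy =>
  (h x hx y hy).trans (by gcongr)

lemma sub (hf : HolderBound c β f K) (hg : HolderBound c' β g K) :
    HolderBound (c + c') β (f - g) K := fun x hx y hy => by
  have h1 := abs_le.1 (hf x hx y hy)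
  have h2 := abs_le.1 (hg x hx y hy)
  simp only [Pi.sub_apply]
  rw [add_mul]
  exact abs_le.2 ⟨by linarith, by linarith⟩

/-- McShane's formula: the infimum over y in K of f(y) + c d(x, y)^β. It works because d^β satisfies
the triangle inequality when β ≤ 1. -/
lemma extension (hK : K.Nonempty) (hc : 0 ≤ c) (hβ : 0 < β) (hβ1 : β ≤ 1)
    (h : HolderBound c β f K) : ∃ F : V → ℝ, (∀ x ∈ K, F x = f x) ∧ HolderBound c β F Set.univ := by
  have : Nonempty K := hK.to_subtype
  obtain ⟨y₀, hy₀⟩ := hK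
  have htri : ∀ x y z : V, dist x z ^ β ≤ dist x y ^ β + dist y z ^ β := fun x y z =>
    (Real.rpow_le_rpow dist_nonneg (dist_triangle x y z) hβ.le).trans
      (Real.rpow_add_le_add_rpow dist_nonneg dist_nonneg hβ.le hβ1)
  let F : V → ℝ := fun x => ⨅ y : K, (f y + c * dist x y ^ β)
  have hbdd : ∀ x : V, BddBelow (Set.range fun y : K => f y + c * dist x (y : V) ^ β) := by
    refine fun x => ⟨f y₀ - c * dist x y₀ ^ β, ?_⟩
    rintro _ ⟨y, rfl⟩
    have h1 := abs_le.1 (h y₀ hy₀ y y.2)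
    have h2 := mul_le_mul_of_nonneg_left (htri y₀ x y) hc
    rw [dist_comm y₀ x] at h2
    simp only
    linarith
  have hone : ∀ x x', F x ≤ F x' + c * dist x x' ^ β := by
    intro x x'
    rw [← sub_le_iff_le_add]
    refine le_ciInf fun y => ?_
    have h1 := ciInf_le (hbdd x) y
    have h2 := mul_le_mul_of_nonneg_left (htri x x' y) hc
    change F x ≤ _ at h1
    linarith
  refine ⟨F, fun x hx => le_antisymm ?_ ?_, fun x _ y _ => abs_le.2 ⟨?_, ?_⟩⟩
  · have := ciInf_le (hbdd x) ⟨x, hx⟩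
    simpa [Real.zero_rpow hβ.ne'] using this
  · refine le_ciInf fun y => ?_
    have h1 := abs_le.1 (h x hx y y.2)
    linarith
  · have := hone y x
    rw [dist_comm] at this
    linarith
  · have := hone x y
    linarith

lemma comp (hf : HolderBound c β f K) {φ : W → V} {M : Set W} {k : ℝ} (hc : 0 ≤ c) (hk : 0 ≤ k)
    (hβ : 0 ≤ β) (hφ : ∀ x y, dist (φ x) (φ y) ≤ k * dist x y) (hM : Set.MapsTo φ M K) :
    HolderBound (c * k ^ β) β (f ∘ φ) M := fun x hx y hy => by
  refine (hf _ (hM hx) _ (hM hy)).trans ?_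
  rw [mul_assoc, ← Real.mul_rpow hk dist_nonneg]
  have := hφ x y
  gcongr

end HolderBound

section IsHolder

variable {V : Type*} [PseudoMetricSpace V] {K : Set V} {β : ℝ} {f : V → ℝ}

/-- `f` is `β`-Hölder on `K`. -/
def IsHolder (β : ℝ) (f : V → ℝ) (K : Set V) : Prop := ∃ c, 0 ≤ c ∧ HolderBound c β f K

lemma IsHolder.add {f' : V → ℝ} (hf : IsHolder β f K) (hf' : IsHolder β f' K) :
    IsHolder β (f + f') K := by
  obtain ⟨c, hc, h⟩ := hf
  obtain ⟨c', hc', h'⟩ := hf'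
  refine ⟨c + c', by positivity, fun x hx y hy => ?_⟩
  have h1 := h x hx y hy
  have h2 := h' x hx y hy
  rw [add_mul, Pi.add_apply, Pi.add_apply, add_sub_add_comm]
  exact (abs_add_le _ _).trans (add_le_add h1 h2)

lemma IsHolder.smul (a : ℝ) (hf : IsHolder β f K) : IsHolder β (a • f) K := by
  obtain ⟨c, hc, h⟩ := hf
  refine ⟨|a| * c, by positivity, fun x hx y hy => ?_⟩
  simp only [Pi.smul_apply, smul_eq_mul]
  rw [← mul_sub, abs_mul, mul_assoc]
  exact mul_le_mul_of_nonneg_left (h x hx y hy) (abs_nonneg a)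

lemma isHolder_zero : IsHolder β (0 : V → ℝ) K := ⟨0, le_rfl, fun x _ y _ => by simp⟩

lemma IsHolder.sum_smul {ι : Type*} (t : Finset ι) (a : ι → ℝ) {F : ι → V → ℝ}
    (hF : ∀ i, IsHolder β (F i) K) : IsHolder β (∑ i ∈ t, a i • F i) K := by
  classical
  induction t using Finset.induction_on with
  | empty => simpa using isHolder_zero
  | insert i t hi ih => rw [Finset.sum_insert hi]; exact ((hF i).smul _).add ih

end IsHolder

lemma HolderBound.continuous {V : Type*} [PseudoMetricSpace V] {c β : ℝ} {f : V → ℝ}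
    (hβ : 0 < β) (hf : HolderBound c β f Set.univ) : Continuous f := by
  rw [continuous_iff_continuousAt]
  intro x
  rw [ContinuousAt, tendsto_iff_dist_tendsto_zero]
  have : Tendsto (fun y => c * dist y x ^ β) (𝓝 x) (𝓝 0) := by
    have h1 : Tendsto (fun y => dist y x) (𝓝 x) (𝓝 0) := by
      simpa using (continuous_id.dist continuous_const).tendsto (x := x) (f := fun y : V => dist y x)
    simpa [Real.zero_rpow hβ.ne'] using (h1.rpow_const (Or.inr hβ.le)).const_mul c
  refine squeeze_zero (fun _ => dist_nonneg) (fun y => ?_) this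
  rw [Real.dist_eq]
  exact hf y trivial x trivial

open MeasureTheory Convolution in
/-- A Hölder function is a pointwise limit of smooth functions with the same Hölder constant. -/
lemma HolderBound.exists_smooth_approx {V : Type*} [NormedAddCommGroup V] [NormedSpace ℝ V]
    [FiniteDimensional ℝ V] {c β : ℝ} {f : V → ℝ} {K : Set V}
    (hK : K.Nonempty) (hc : 0 ≤ c) (hβ : 0 < β) (hβ1 : β ≤ 1) (h : HolderBound c β f K) :
    ∃ F : ℕ → V → ℝ, (∀ n, ContDiff ℝ 3 (F n)) ∧ (∀ n, HolderBound c β (F n) K) ∧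
      ∀ x ∈ K, Tendsto (fun n => F n x) atTop (𝓝 (f x)) := by
  borelize V
  obtain ⟨f', hf', hf'c⟩ := h.extension hK hc hβ hβ1
  have hcont : Continuous f' := hf'c.continuous hβ
  -- Mollifiers of outer radius 1/(n + 1). Averaging translates of the global extension preserves
  -- its Hölder constant. Class C³ leaves room for the Jacobian of the approximants to be C².
  let φ : ℕ → ContDiffBump (0 : V) := fun n =>
    ⟨1 / (n + 1) / 2, 1 / (n + 1), by positivity, half_lt_self (by positivity)⟩
  let μ : Measure V := Measure.addHaar
  refine ⟨fun n => (φ n).normed μ ⋆[ContinuousLinearMap.lsmul ℝ ℝ, μ] f', fun n => ?_,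
    fun n x _ y _ => ?_, fun x hx => ?_⟩
  · exact (φ n).hasCompactSupport_normed.contDiff_convolution_left _ (φ n).contDiff_normed
      hcont.locallyIntegrable
  · have hint : ∀ z, Integrable (fun t => (φ n).normed μ t * f' (z - t)) μ := fun z =>
      Continuous.integrable_of_hasCompactSupport
        ((φ n).contDiff_normed (n := 0) |>.continuous.mul (hcont.comp (by fun_prop)))
        (φ n).hasCompactSupport_normed.mul_right
    simp only [convolution, ContinuousLinearMap.lsmul_apply, smul_eq_mul]
    rw [← integral_sub (hint x) (hint y), ← Real.norm_eq_abs]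
    calc ‖∫ t, ((φ n).normed μ t * f' (x - t) - (φ n).normed μ t * f' (y - t)) ∂μ‖
        ≤ ∫ t, (φ n).normed μ t * (c * dist x y ^ β) ∂μ := by
          refine norm_integral_le_of_norm_le ((φ n).integrable_normed.mul_const _)
            (Eventually.of_forall fun t => ?_)
          rw [← mul_sub, norm_mul, Real.norm_of_nonneg ((φ n).nonneg_normed t), Real.norm_eq_abs]
          have := hf'c (x - t) trivial (y - t) trivial
          rw [dist_sub_right] at this
          exact mul_le_mul_of_nonneg_left this ((φ n).nonneg_normed t)
      _ = c * dist x y ^ β := by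
          rw [integral_mul_const, (φ n).integral_normed, one_mul]
  · rw [← hf' x hx]
    refine ContDiffBump.convolution_tendsto_right_of_continuous ?_ hcont x
    exact tendsto_one_div_add_atTop_nhds_zero_nat

open MeasureTheory Convolution in
/-- A `C²` function on the plane has a `C²` antiderivative in the first variable. -/
lemma exists_contDiff_antideriv_fst {F : ℝ × ℝ → ℝ} (hF : ContDiff ℝ 2 F) :
    ∃ A : ℝ × ℝ → ℝ, ContDiff ℝ 2 A ∧ ∀ p, fderiv ℝ A p (1, 0) = F p := by
  -- The antiderivative is ∫₀¹ p₁ F(t p₁, p₂) dt, written as the value at 0 of a convolution with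
  -- the indicator of (0, 1], so that smoothness of convolutions depending on a parameter applies.
  -- The cutoff `χ` supplies the compact support and equals 1 where the integrand matters.
  let χ : ContDiffBump (0 : ℝ) := ⟨2, 3, by norm_num, by norm_num⟩
  let g : ℝ × ℝ → ℝ → ℝ := fun p t => χ t * (p.1 * F (-t * p.1, p.2))
  let u : ℝ → ℝ := (Set.Ioc (0 : ℝ) 1).indicator fun _ => 1
  let A : ℝ × ℝ → ℝ := fun p => (u ⋆[ContinuousLinearMap.mul ℝ ℝ, volume] g p) 0
  have hu : LocallyIntegrable u volume :=
    ((integrable_indicator_iff measurableSet_Ioc).2 (by simp)).locallyIntegrable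
  have hA : ContDiff ℝ 2 A := by
    rw [← contDiffOn_univ]
    refine contDiffOn_convolution_right_with_param_comp (n := 2) (k := Metric.closedBall 0 3)
      (ContinuousLinearMap.mul ℝ ℝ) contDiffOn_const isOpen_univ
      (isCompact_closedBall _ _) (fun p x _ hx => ?_) hu ?_
    · have : χ x = 0 := χ.zero_of_le_dist (by simpa [χ] using (not_le.1 (by simpa using hx)).le)
      simp [g, this]
    · rw [Set.univ_prod_univ, contDiffOn_univ]
      have : ContDiff ℝ 2 (fun t : ℝ => χ t) := χ.contDiff
      change ContDiff ℝ 2 fun q : (ℝ × ℝ) × ℝ => χ q.2 * (q.1.1 * F (-q.2 * q.1.1, q.1.2))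
      fun_prop
  have hAeq : ∀ p : ℝ × ℝ, A p = ∫ s in (0 : ℝ)..p.1, F (s, p.2) := by
    intro p
    have h1 : A p = ∫ t in (0 : ℝ)..1, p.1 * F (t * p.1, p.2) := by
      rw [intervalIntegral.integral_of_le zero_le_one, ← integral_indicator measurableSet_Ioc]
      refine integral_congr_ae (Eventually.of_forall fun t => ?_)
      by_cases ht : t ∈ Set.Ioc (0 : ℝ) 1
      · have : χ (-t) = 1 := χ.one_of_mem_closedBall (by
          simp only [Metric.mem_closedBall, dist_zero_right, norm_neg, Real.norm_eq_abs, χ]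
          rw [abs_of_pos ht.1]
          linarith [ht.2])
        simp [u, g, ht, this]
      · simp [u, ht]
    rw [h1, intervalIntegral.integral_const_mul, intervalIntegral.mul_integral_comp_mul_right
      (f := fun s => F (s, p.2))]
    simp
  refine ⟨A, hA, fun p => ?_⟩
  have h1 : HasDerivAt (fun x => A (x, p.2)) (fderiv ℝ A p (1, 0)) p.1 := by
    have h2 : HasFDerivAt A (fderiv ℝ A p) (p.1, p.2) :=
      (hA.differentiable (by norm_num) p).hasFDerivAt
    exact h2.comp_hasDerivAt p.1 ((hasDerivAt_id p.1).prodMk (hasDerivAt_const p.1 p.2))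
  have hc : Continuous fun s => F (s, p.2) := hF.continuous.comp (by fun_prop)
  have h3 : HasDerivAt (fun x => A (x, p.2)) (F (p.1, p.2)) p.1 := by
    simp only [hAeq]
    exact intervalIntegral.integral_hasDerivAt_right (hc.intervalIntegrable _ _)
      (hc.stronglyMeasurableAtFilter _ _) hc.continuousAt
  exact h1.unique h3

/-! ### Linearity and naturality of the sewing limit -/

section SewingLinear

variable {X Y ι : Type*} [Fintype ι] {ch : ι → X → X}

lemma refine_iterate_zero (n : ℕ) : (refine ch)^[n] 0 = 0 := by
  simpa using refine_iterate_smul (ch := ch) 0 0 n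

lemma sewLim_add {a b : X → ℝ} {x : X}
    (ha : Tendsto (fun n => (refine ch)^[n] a x) atTop (𝓝 (sewLim ch a x)))
    (hb : Tendsto (fun n => (refine ch)^[n] b x) atTop (𝓝 (sewLim ch b x))) :
    sewLim ch (a + b) x = sewLim ch a x + sewLim ch b x := by
  refine Tendsto.limUnder_eq ?_
  simp only [refine_iterate_add]
  exact ha.add hb

lemma sewLim_smul {a : X → ℝ} {x : X} (c : ℝ)
    (ha : Tendsto (fun n => (refine ch)^[n] a x) atTop (𝓝 (sewLim ch a x))) :
    sewLim ch (c • a) x = c * sewLim ch a x := by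
  refine Tendsto.limUnder_eq ?_
  simp only [refine_iterate_smul]
  exact ha.const_mul c

/-- For maps that commute with subdivision; affine maps do, which gives the pull-back formulas for
Young and Züst germs. -/
lemma sewLim_comp {ch' : ι → Y → Y} {Φ : Y → X} (h : ∀ i y, ch i (Φ y) = Φ (ch' i y))
    (a : X → ℝ) (y : Y) : sewLim ch a (Φ y) = sewLim ch' (a ∘ Φ) y := by
  have : ∀ n (a : X → ℝ) y, (refine ch)^[n] a (Φ y) = (refine ch')^[n] (a ∘ Φ) y := by
    intro n
    induction n with
    | zero => intros; rfl
    | succ n ih =>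
      intro a y
      rw [Function.iterate_succ_apply, ih]
      simp only [Function.iterate_succ_apply]
      have hstep : refine ch a ∘ Φ = refine ch' (a ∘ Φ) := by
        funext y
        simp [refine, h]
      rw [hstep]
  simp only [sewLim, this]

end SewingLinear

/-! ### Young germs on pairs of points -/

section Young

variable {V W : Type*} [NormedAddCommGroup V] [NormedSpace ℝ V]
  [NormedAddCommGroup W] [NormedSpace ℝ W]

/-- The two halves of a segment. -/
noncomputable def segCh : Fin 2 → V × V → V × V :=
  ![fun x => (x.1, midpoint ℝ x.1 x.2), fun x => (midpoint ℝ x.1 x.2, x.2)]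

/-- The germ `f ∪ δg` on pairs of points. -/
def cupDelta (f g : V → ℝ) : V × V → ℝ := fun x => f x.1 * (g x.2 - g x.1)

/-- The Young integral of `f dg` over the segment `[p q]`. -/
noncomputable def young (f g : V → ℝ) (p q : V) : ℝ := sewLim segCh (cupDelta f g) (p, q)

lemma refine_segCh (a : V × V → ℝ) (p q : V) :
    refine segCh a (p, q) = a (p, midpoint ℝ p q) + a (midpoint ℝ p q, q) := by
  simp [refine, segCh]

lemma halving_segCh {K : Set V} (hK : Convex ℝ K) :
    Halving segCh (fun x : V × V => x.1 ∈ K ∧ x.2 ∈ K) fun x => dist x.1 x.2 where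
  nonneg _ := dist_nonneg
  mem i x hx := by
    have := hK.midpoint_mem hx.1 hx.2
    fin_cases i <;> simp [segCh, hx.1, hx.2, this]
  le i x _ := by
    fin_cases i <;> simp [segCh, div_eq_inv_mul]

lemma two_lt_two_rpow {γ : ℝ} (hγ : 1 < γ) : (Fintype.card (Fin 2) : ℝ) < 2 ^ γ := by
  simpa using Real.rpow_lt_rpow_of_exponent_lt (x := 2) (by norm_num) hγ

variable {K : Set V} {β cf cg : ℝ} {f g : V → ℝ}

/-- With m the midpoint, the defect is exactly (f(m) - f(p)) (g(q) - g(m)), a product of two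
increments. -/
lemma abs_refine_cupDelta_sub_le (hK : Convex ℝ K) (hβ : 1 / 2 < β) (hcf : 0 ≤ cf)
    (hcg : 0 ≤ cg) (hf : HolderBound cf β f K) (hg : HolderBound cg β g K) :
    ∀ x : V × V, x.1 ∈ K ∧ x.2 ∈ K →
      |refine segCh (cupDelta f g) x - cupDelta f g x| ≤ cf * cg * dist x.1 x.2 ^ (2 * β) := by
  rintro ⟨p, q⟩ ⟨hp, hq⟩
  have hm := hK.midpoint_mem hp hq
  have h1 := hf _ hm _ hp
  have h2 := hg _ hq _ hm
  have d1 : dist (midpoint ℝ p q) p ≤ dist p q := by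
    rw [dist_midpoint_left]; simp; linarith [dist_nonneg (x := p) (y := q)]
  have d2 : dist q (midpoint ℝ p q) ≤ dist p q := by
    rw [dist_right_midpoint]; simp; linarith [dist_nonneg (x := p) (y := q)]
  have e1 : dist (midpoint ℝ p q) p ^ β ≤ dist p q ^ β :=
    Real.rpow_le_rpow dist_nonneg d1 (by linarith)
  have e2 : dist q (midpoint ℝ p q) ^ β ≤ dist p q ^ β :=
    Real.rpow_le_rpow dist_nonneg d2 (by linarith)
  rw [refine_segCh]
  have : cupDelta f g (p, midpoint ℝ p q) + cupDelta f g (midpoint ℝ p q, q) - cupDelta f g (p, q)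
      = (f (midpoint ℝ p q) - f p) * (g q - g (midpoint ℝ p q)) := by
    simp only [cupDelta]; ring
  rw [this, abs_mul, two_mul, Real.rpow_add_of_nonneg dist_nonneg (by linarith) (by linarith)]
  calc _ ≤ (cf * dist p q ^ β) * (cg * dist p q ^ β) := by
        refine mul_le_mul (h1.trans ?_) (h2.trans ?_) (abs_nonneg _) (by positivity) <;> gcongr
    _ = _ := by ring

/-- The constant in the sewing estimate for `γ`-sewing of segments. -/
noncomputable def youngConst (β : ℝ) : ℝ := 1 / (1 - 2 / 2 ^ (2 * β))

lemma youngConst_nonneg (hβ : 1 / 2 < β) : 0 ≤ youngConst β := by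
  have := card_div_lt_one (two_lt_two_rpow (γ := 2 * β) (by linarith))
  simp only [Fintype.card_fin, Nat.cast_ofNat] at this
  exact div_nonneg zero_le_one (by linarith)

lemma young_near (hK : Convex ℝ K) (hβ : 1 / 2 < β) (hcf : 0 ≤ cf) (hcg : 0 ≤ cg)
    (hf : HolderBound cf β f K) (hg : HolderBound cg β g K) {p q : V} (hp : p ∈ K) (hq : q ∈ K) :
    |young f g p q - f p * (g q - g p)| ≤ youngConst β * (cf * cg * dist p q ^ (2 * β)) := by
  have := abs_sewLim_sub_le (halving_segCh hK) (by linarith) (mul_nonneg hcf hcg)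
    (two_lt_two_rpow (by linarith)) (abs_refine_cupDelta_sub_le hK hβ hcf hcg hf hg)
    (x := (p, q)) ⟨hp, hq⟩
  simpa [young, youngConst, cupDelta, div_eq_inv_mul] using this

lemma tendsto_young (hK : Convex ℝ K) (hβ : 1 / 2 < β) (hf : IsHolder β f K) (hg : IsHolder β g K)
    {p q : V} (hp : p ∈ K) (hq : q ∈ K) :
    Tendsto (fun n => (refine segCh)^[n] (cupDelta f g) (p, q)) atTop (𝓝 (young f g p q)) := by
  obtain ⟨cf, hcf, hf⟩ := hf
  obtain ⟨cg, hcg, hg⟩ := hg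
  exact tendsto_sewLim (halving_segCh hK) (by linarith) (mul_nonneg hcf hcg)
    (two_lt_two_rpow (by linarith)) (abs_refine_cupDelta_sub_le hK hβ hcf hcg hf hg)
    (x := (p, q)) ⟨hp, hq⟩

/-- Uniqueness of sewing on segments: it identifies the Young germ with an explicit candidate once
the latter is additive at midpoints and close to order γ > 1. -/
lemma young_eq_of_near {a : V → V → ℝ} {C γ : ℝ} (hK : Convex ℝ K) (hγ : 1 < γ) (hC : 0 ≤ C)
    (hadd : ∀ p ∈ K, ∀ q ∈ K, a p (midpoint ℝ p q) + a (midpoint ℝ p q) q = a p q)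
    (hnear : ∀ p ∈ K, ∀ q ∈ K, |a p q - f p * (g q - g p)| ≤ C * dist p q ^ γ)
    {p q : V} (hp : p ∈ K) (hq : q ∈ K) : young f g p q = a p q :=
  sewLim_eq (a := cupDelta f g) (halving_segCh hK) (by linarith) hC (two_lt_two_rpow hγ)
    (b := fun x => a x.1 x.2) (x := (p, q))
    (fun x hx => by rw [← Prod.mk.eta (p := x), refine_segCh]; exact hadd _ hx.1 _ hx.2)
    (fun x hx => hnear _ hx.1 _ hx.2) ⟨hp, hq⟩

lemma young_add_left {f' : V → ℝ} (hK : Convex ℝ K) (hβ : 1 / 2 < β) (hf : IsHolder β f K)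
    (hf' : IsHolder β f' K) (hg : IsHolder β g K) {p q : V} (hp : p ∈ K) (hq : q ∈ K) :
    young (f + f') g p q = young f g p q + young f' g p q := by
  have : cupDelta (f + f') g = cupDelta f g + cupDelta f' g := by
    funext x; simp [cupDelta, add_mul]
  rw [young, this, sewLim_add (tendsto_young hK hβ hf hg hp hq) (tendsto_young hK hβ hf' hg hp hq)]
  rfl

lemma young_add_right {g' : V → ℝ} (hK : Convex ℝ K) (hβ : 1 / 2 < β) (hf : IsHolder β f K)
    (hg : IsHolder β g K) (hg' : IsHolder β g' K) {p q : V} (hp : p ∈ K) (hq : q ∈ K) :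
    young f (g + g') p q = young f g p q + young f g' p q := by
  have : cupDelta f (g + g') = cupDelta f g + cupDelta f g' := by
    funext x; simp [cupDelta]; ring
  rw [young, this, sewLim_add (tendsto_young hK hβ hf hg hp hq) (tendsto_young hK hβ hf hg' hp hq)]
  rfl

lemma young_smul_left (c : ℝ) (hK : Convex ℝ K) (hβ : 1 / 2 < β) (hf : IsHolder β f K)
    (hg : IsHolder β g K) {p q : V} (hp : p ∈ K) (hq : q ∈ K) :
    young (c • f) g p q = c * young f g p q := by
  have : cupDelta (c • f) g = c • cupDelta f g := by
    funext x; simp [cupDelta, mul_assoc]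
  rw [young, this, sewLim_smul c (tendsto_young hK hβ hf hg hp hq)]
  rfl

lemma young_smul_right (c : ℝ) (hK : Convex ℝ K) (hβ : 1 / 2 < β) (hf : IsHolder β f K)
    (hg : IsHolder β g K) {p q : V} (hp : p ∈ K) (hq : q ∈ K) :
    young f (c • g) p q = c * young f g p q := by
  have : cupDelta f (c • g) = c • cupDelta f g := by
    funext x; simp [cupDelta]; ring
  rw [young, this, sewLim_smul c (tendsto_young hK hβ hf hg hp hq)]
  rfl

lemma young_zero_left (g : V → ℝ) (p q : V) : young 0 g p q = 0 := by
  refine Tendsto.limUnder_eq ?_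
  have : cupDelta (0 : V → ℝ) g = 0 := by funext x; simp [cupDelta]
  simp [this, refine_iterate_zero]

lemma young_zero_right (f : V → ℝ) (p q : V) : young f 0 p q = 0 := by
  refine Tendsto.limUnder_eq ?_
  have : cupDelta f (0 : V → ℝ) = 0 := by funext x; simp [cupDelta]
  simp [this, refine_iterate_zero]

lemma young_sum_smul_left {ι : Type*} (t : Finset ι) (a : ι → ℝ) {F : ι → V → ℝ}
    (hK : Convex ℝ K) (hβ : 1 / 2 < β) (hF : ∀ i, IsHolder β (F i) K)
    (hg : IsHolder β g K) {p q : V} (hp : p ∈ K) (hq : q ∈ K) :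
    young (∑ i ∈ t, a i • F i) g p q = ∑ i ∈ t, a i * young (F i) g p q := by
  classical
  induction t using Finset.induction_on with
  | empty => simpa using young_zero_left g p q
  | insert i t hi ih =>
    rw [Finset.sum_insert hi, Finset.sum_insert hi, young_add_left hK hβ ((hF i).smul _)
      (IsHolder.sum_smul t a hF) hg hp hq, young_smul_left _ hK hβ (hF i) hg hp hq, ih]

lemma young_sum_smul_right {ι : Type*} (t : Finset ι) (a : ι → ℝ) {F : ι → V → ℝ}
    (hK : Convex ℝ K) (hβ : 1 / 2 < β) (hF : ∀ i, IsHolder β (F i) K)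
    (hf : IsHolder β f K) {p q : V} (hp : p ∈ K) (hq : q ∈ K) :
    young f (∑ i ∈ t, a i • F i) p q = ∑ i ∈ t, a i * young f (F i) p q := by
  classical
  induction t using Finset.induction_on with
  | empty => simpa using young_zero_right f p q
  | insert i t hi ih =>
    rw [Finset.sum_insert hi, Finset.sum_insert hi, young_add_right hK hβ hf ((hF i).smul _)
      (IsHolder.sum_smul t a hF) hp hq, young_smul_right _ hK hβ hf (hF i) hp hq, ih]

/-- The increment of fg is additive and differs from f ∪ δg + g ∪ δf by the product of the
increments of f and g, which has order 2β > 1. -/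
lemma young_leibniz (hK : Convex ℝ K) (hβ : 1 / 2 < β) (hf : IsHolder β f K)
    (hg : IsHolder β g K) {p q : V} (hp : p ∈ K) (hq : q ∈ K) :
    young f g p q + young g f p q = f q * g q - f p * g p := by
  have h1 := sewLim_add (tendsto_young hK hβ hf hg hp hq) (tendsto_young hK hβ hg hf hp hq)
  rw [young, young, ← h1]
  obtain ⟨cf, hcf, hf⟩ := hf
  obtain ⟨cg, hcg, hg⟩ := hg
  refine sewLim_eq (halving_segCh hK) (γ := 2 * β) (by linarith) (mul_nonneg hcf hcg)
    (two_lt_two_rpow (by linarith)) (b := fun x => f x.2 * g x.2 - f x.1 * g x.1) (x := (p, q))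
    (fun x hx => ?_) (fun x hx => ?_) ⟨hp, hq⟩
  · rw [← Prod.mk.eta (p := x), refine_segCh]; ring
  · have h1 := hf _ hx.1 _ hx.2
    have h2 := hg _ hx.1 _ hx.2
    have : f x.2 * g x.2 - f x.1 * g x.1 - (cupDelta f g + cupDelta g f) x =
        (f x.1 - f x.2) * (g x.1 - g x.2) := by
      simp only [cupDelta, Pi.add_apply]; ring
    rw [this, abs_mul, two_mul, Real.rpow_add_of_nonneg dist_nonneg (by linarith) (by linarith)]
    calc _ ≤ (cf * dist x.1 x.2 ^ β) * (cg * dist x.1 x.2 ^ β) :=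
          mul_le_mul h1 h2 (abs_nonneg _) (by positivity)
      _ = _ := by ring

lemma young_comp (φ : W →ᵃ[ℝ] V) (f g : V → ℝ) (s t : W) :
    young f g (φ s) (φ t) = young (f ∘ φ) (g ∘ φ) s t := by
  refine sewLim_comp (Φ := fun x : W × W => (φ x.1, φ x.2)) (fun i y => ?_) (cupDelta f g) (s, t)
  fin_cases i <;> simp [segCh, φ.map_midpoint]

lemma tendsto_young_of_tendsto {F G : ℕ → V → ℝ} (hK : Convex ℝ K) (hβ : 1 / 2 < β)
    (hcf : 0 ≤ cf) (hcg : 0 ≤ cg) (hF : ∀ n, HolderBound cf β (F n) K)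
    (hG : ∀ n, HolderBound cg β (G n) K)
    (hFf : ∀ x ∈ K, Tendsto (fun n => F n x) atTop (𝓝 (f x)))
    (hGg : ∀ x ∈ K, Tendsto (fun n => G n x) atTop (𝓝 (g x))) {p q : V} (hp : p ∈ K)
    (hq : q ∈ K) : Tendsto (fun n => young (F n) (G n) p q) atTop (𝓝 (young f g p q)) :=
  tendsto_sewLim_of_tendsto (halving_segCh hK) (γ := 2 * β) (by linarith) (mul_nonneg hcf hcg)
    (two_lt_two_rpow (by linarith))
    (fun n => abs_refine_cupDelta_sub_le hK hβ hcf hcg (hF n) (hG n))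
    (fun x hx => (hFf _ hx.1).mul ((hGg _ hx.2).sub (hGg _ hx.1))) (x := (p, q)) ⟨hp, hq⟩

end Young

/-! ### Young germs are closed on lines -/

lemma exists_holderBound_one {V : Type*} [NormedAddCommGroup V] [NormedSpace ℝ V] {f : V → ℝ}
    (hf : ContDiff ℝ 1 f) {K : Set V} (hK : IsCompact K) : IsHolder 1 f K := by
  obtain ⟨c, hc⟩ := hf.locallyLipschitz.locallyLipschitzOn.exists_lipschitzOnWith_of_compact hK
  refine ⟨c, c.2, fun x hx y hy => ?_⟩
  simpa [Real.dist_eq] using hc.dist_le_mul x hx y hy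

/-- Sewing only gives additivity at midpoints. For C¹ functions the Young germ is the increment of
an antiderivative of f g', which is additive at every point. -/
lemma young_add_real_of_contDiff {f g : ℝ → ℝ} (hf : ContDiff ℝ 1 f) (hg : ContDiff ℝ 1 g)
    (x y z : ℝ) : young f g x y + young f g y z = young f g x z := by
  let K : Set ℝ := convexHull ℝ {x, y, z}
  have hK : Convex ℝ K := convex_convexHull ℝ _
  have hKc : IsCompact K := (Set.toFinite {x, y, z}).isCompact_convexHull ℝ
  have hsub : {x, y, z} ⊆ K := subset_convexHull ℝ _
  have hg' : Continuous (deriv g) := hg.continuous_deriv le_rfl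
  let A : ℝ → ℝ := fun t => ∫ u in (0 : ℝ)..t, f u * deriv g u
  have hA : ∀ t, HasDerivAt A (f t * deriv g t) t := fun t =>
    (hf.continuous.mul hg').integral_hasStrictDerivAt 0 t |>.hasDerivAt
  obtain ⟨c, hc, hfc⟩ := exists_holderBound_one hf hKc
  obtain ⟨M, hM⟩ := hKc.exists_bound_of_continuousOn hg'.continuousOn
  have key : ∀ p ∈ K, ∀ q ∈ K, young f g p q = A q - A p := by
    intro p hp q hq
    have hM0 : 0 ≤ M := (norm_nonneg _).trans (hM p hp)
    refine young_eq_of_near (γ := 2) (C := c * M) (a := fun p q => A q - A p) hK (by norm_num)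
      (by positivity) (fun p _ q _ => by ring) (fun p hp q hq => ?_) hp hq
    have hseg : segment ℝ p q ⊆ K := hK.segment_subset hp hq
    -- The function A - f(p) g has derivative (f(u) - f(p)) g'(u), of size O(|q - p|) on the
    -- segment; the mean value inequality yields an error of order 2.
    have hb := Convex.norm_image_sub_le_of_norm_hasDerivWithin_le (s := segment ℝ p q)
      (f := fun u => A u - f p * g u) (f' := fun u => f u * deriv g u - f p * deriv g u)
      (C := c * dist p q * M)
      (fun u _ => ((hA u).sub (((hg.differentiable (by norm_num) u).hasDerivAt).const_mul
        (f p))).hasDerivWithinAt) (fun u hu => ?_) (convex_segment p q) (left_mem_segment ℝ p q)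
      (right_mem_segment ℝ p q)
    · rw [Real.norm_eq_abs, Real.norm_eq_abs] at hb
      have e1 : A q - f p * g q - (A p - f p * g p) = A q - A p - f p * (g q - g p) := by ring
      rw [e1] at hb
      refine hb.trans (le_of_eq ?_)
      rw [Real.rpow_two, dist_comm, Real.dist_eq]
      ring
    · rw [← sub_mul, norm_mul, Real.norm_eq_abs]
      have h1 := hfc u (hseg hu) p hp
      rw [Real.rpow_one] at h1
      have h2 : dist u p ≤ dist p q := by
        rw [dist_comm u p, ← dist_add_dist_of_mem_segment hu]
        linarith [dist_nonneg (x := u) (y := q)]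
      exact mul_le_mul (h1.trans (by gcongr)) (hM u (hseg hu)) (norm_nonneg _) (by positivity)
  rw [key x (hsub (by simp)) y (hsub (by simp)), key y (hsub (by simp)) z (hsub (by simp)),
    key x (hsub (by simp)) z (hsub (by simp))]
  ring

/-- The smooth case passes to the limit along mollifications, whose Hölder constants on K are
uniform. -/
lemma young_add_real {f g : ℝ → ℝ} {K : Set ℝ} {β : ℝ} (hK : Convex ℝ K) (hβ : 1 / 2 < β)
    (hβ1 : β ≤ 1) (hf : IsHolder β f K) (hg : IsHolder β g K) {x y z : ℝ} (hx : x ∈ K)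
    (hy : y ∈ K) (hz : z ∈ K) : young f g x y + young f g y z = young f g x z := by
  obtain ⟨cf, hcf, hf⟩ := hf
  obtain ⟨cg, hcg, hg⟩ := hg
  obtain ⟨F, hF, hFh, hFf⟩ := hf.exists_smooth_approx ⟨x, hx⟩ hcf (by linarith) hβ1
  obtain ⟨G, hG, hGh, hGg⟩ := hg.exists_smooth_approx ⟨x, hx⟩ hcg (by linarith) hβ1
  have ht : ∀ {p q}, p ∈ K → q ∈ K →
      Tendsto (fun n => young (F n) (G n) p q) atTop (𝓝 (young f g p q)) := fun hp hq =>
    tendsto_young_of_tendsto hK hβ hcf hcg hFh hGh hFf hGg hp hq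
  refine tendsto_nhds_unique ?_ (ht hx hz)
  have := (ht hx hy).add (ht hy hz)
  simpa only [young_add_real_of_contDiff ((hF _).of_le (by norm_num))
    ((hG _).of_le (by norm_num))] using this

section Line

variable {V : Type*} [NormedAddCommGroup V] [NormedSpace ℝ V] {K : Set V} {β : ℝ} {f g : V → ℝ}

lemma IsHolder.comp_affine {W : Type*} [NormedAddCommGroup W] [NormedSpace ℝ W]
    [FiniteDimensional ℝ W] (hf : IsHolder β f K) (hβ : 0 ≤ β) (φ : W →ᵃ[ℝ] V) :
    IsHolder β (f ∘ φ) (φ ⁻¹' K) := by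
  obtain ⟨c, hc, hf⟩ := hf
  let L : W →L[ℝ] V := LinearMap.toContinuousLinearMap φ.linear
  refine ⟨c * ‖L‖ ^ β, by positivity, hf.comp hc (norm_nonneg L) hβ (fun x y => ?_) fun _ h => h⟩
  rw [dist_eq_norm, dist_eq_norm, ← vsub_eq_sub (φ x), ← φ.linearMap_vsub, vsub_eq_sub]
  exact L.le_opNorm _

lemma young_add_line (hK : Convex ℝ K) (hβ : 1 / 2 < β) (hβ1 : β ≤ 1) (hf : IsHolder β f K)
    (hg : IsHolder β g K) (φ : ℝ →ᵃ[ℝ] V) {x y z : ℝ} (hx : φ x ∈ K) (hy : φ y ∈ K)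
    (hz : φ z ∈ K) :
    young f g (φ x) (φ y) + young f g (φ y) (φ z) = young f g (φ x) (φ z) := by
  simp only [young_comp]
  exact young_add_real (hK.affine_preimage φ) hβ hβ1 (hf.comp_affine (by linarith) φ)
    (hg.comp_affine (by linarith) φ) hx hy hz

/-- Additivity along a line includes degenerate triples: (p, p, p) gives this, and (p, q, p) gives
`young_symm`. -/
lemma young_self (hK : Convex ℝ K) (hβ : 1 / 2 < β) (hβ1 : β ≤ 1) (hf : IsHolder β f K)
    (hg : IsHolder β g K) {p : V} (hp : p ∈ K) : young f g p p = 0 := by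
  have := young_add_line hK hβ hβ1 hf hg (AffineMap.lineMap p p) (x := 0) (y := 0) (z := 0)
    (by simpa) (by simpa) (by simpa)
  simpa using this

lemma young_symm (hK : Convex ℝ K) (hβ : 1 / 2 < β) (hβ1 : β ≤ 1) (hf : IsHolder β f K)
    (hg : IsHolder β g K) {p q : V} (hp : p ∈ K) (hq : q ∈ K) :
    young f g q p = -young f g p q := by
  have := young_add_line hK hβ hβ1 hf hg (AffineMap.lineMap p q) (x := 0) (y := 1) (z := 0)
    (by simpa) (by simpa) (by simpa)
  simp only [AffineMap.lineMap_apply_zero, AffineMap.lineMap_apply_one,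
    young_self hK hβ hβ1 hf hg hp] at this
  linarith

lemma young_midpoint (hK : Convex ℝ K) (hβ : 1 / 2 < β) (hβ1 : β ≤ 1) (hf : IsHolder β f K)
    (hg : IsHolder β g K) {p q : V} (hp : p ∈ K) (hq : q ∈ K) :
    young f g p (midpoint ℝ p q) + young f g (midpoint ℝ p q) q = young f g p q := by
  have hm := hK.midpoint_mem hp hq
  have e : AffineMap.lineMap p q (1 / 2 : ℝ) = midpoint ℝ p q := by simp [midpoint]
  have := young_add_line hK hβ hβ1 hf hg (AffineMap.lineMap p q) (x := 0) (y := 1 / 2) (z := 1)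
    (by simpa) (by rwa [e]) (by simpa)
  simpa only [AffineMap.lineMap_apply_zero, AffineMap.lineMap_apply_one, e] using this

end Line

/-! ### Züst germs on triples of points -/

section Zust

variable {V W : Type*} [NormedAddCommGroup V] [NormedSpace ℝ V]
  [NormedAddCommGroup W] [NormedSpace ℝ W]

/-- The four homothetic triangles of the dyadic subdivision of a triangle. -/
noncomputable def triCh : Fin 4 → V × V × V → V × V × V :=
  ![fun x => (x.1, midpoint ℝ x.1 x.2.1, midpoint ℝ x.1 x.2.2),
    fun x => (midpoint ℝ x.1 x.2.1, x.2.1, midpoint ℝ x.2.1 x.2.2),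
    fun x => (midpoint ℝ x.1 x.2.2, midpoint ℝ x.2.1 x.2.2, x.2.2),
    fun x => (midpoint ℝ x.2.1 x.2.2, midpoint ℝ x.1 x.2.2, midpoint ℝ x.1 x.2.1)]

/-- The triples of points of `K`. -/
def InTri (K : Set V) (x : V × V × V) : Prop := x.1 ∈ K ∧ x.2.1 ∈ K ∧ x.2.2 ∈ K

/-- The perimeter of a triangle. -/
def perim (x : V × V × V) : ℝ := dist x.1 x.2.1 + dist x.2.1 x.2.2 + dist x.1 x.2.2

/-- The coboundary of a function of pairs of points. -/
def bdry (a : V → V → ℝ) (x : V × V × V) : ℝ := a x.2.1 x.2.2 - a x.1 x.2.2 + a x.1 x.2.1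

/-- The germ `f ∪ δ(g dh)` on triples of points. -/
noncomputable def cupBdry (f g h : V → ℝ) : V × V × V → ℝ := fun x => f x.1 * bdry (young g h) x

/-- The Züst integral of `f dg ∧ dh` over the triangle `[p q r]`. -/
noncomputable def zust (f g h : V → ℝ) (x : V × V × V) : ℝ := sewLim triCh (cupBdry f g h) x

lemma triCh_map (φ : W →ᵃ[ℝ] V) (i : Fin 4) (y : W × W × W) :
    triCh i (φ y.1, φ y.2.1, φ y.2.2) =
      (φ (triCh i y).1, φ (triCh i y).2.1, φ (triCh i y).2.2) := by
  fin_cases i <;> simp [triCh, φ.map_midpoint]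

omit [NormedSpace ℝ V] in
lemma perim_nonneg (x : V × V × V) : 0 ≤ perim x := by unfold perim; positivity

lemma refine_triCh (a : V × V × V → ℝ) (p q r : V) :
    refine triCh a (p, q, r) = a (p, midpoint ℝ p q, midpoint ℝ p r) +
      a (midpoint ℝ p q, q, midpoint ℝ q r) + a (midpoint ℝ p r, midpoint ℝ q r, r) +
      a (midpoint ℝ q r, midpoint ℝ p r, midpoint ℝ p q) := by
  simp [refine, triCh, Fin.sum_univ_four]

lemma halving_triCh {K : Set V} (hK : Convex ℝ K) : Halving triCh (InTri K) perim where
  nonneg := perim_nonneg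
  mem i x hx := by
    obtain ⟨p, q, r⟩ := x
    obtain ⟨hp, hq, hr⟩ := hx
    have h1 := hK.midpoint_mem hp hq
    have h2 := hK.midpoint_mem hp hr
    have h3 := hK.midpoint_mem hq hr
    fin_cases i <;> simp_all [triCh, InTri]
  le i x _ := by
    obtain ⟨p, q, r⟩ := x
    have e : ∀ a b c : V, dist (midpoint ℝ a b) (midpoint ℝ a c) ≤ dist b c / 2 := fun a b c => by
      simpa using dist_midpoint_midpoint_le a b a c
    have h1 := e p q r
    have h2 := e q p r
    have h3 := e r p q
    rw [midpoint_comm q p] at h2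
    rw [midpoint_comm r p, midpoint_comm r q] at h3
    have d1 := dist_comm (midpoint ℝ p q) (midpoint ℝ p r)
    have d2 := dist_comm (midpoint ℝ p q) (midpoint ℝ q r)
    have d3 := dist_comm (midpoint ℝ p r) (midpoint ℝ q r)
    fin_cases i <;> simp [triCh, perim] <;> linarith

lemma four_lt_two_rpow {γ : ℝ} (hγ : 2 < γ) : (Fintype.card (Fin 4) : ℝ) < 2 ^ γ := by
  have := Real.rpow_lt_rpow_of_exponent_lt (x := 2) (by norm_num) hγ
  rw [Real.rpow_two] at this
  norm_num at this ⊢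
  exact this

variable {K : Set V} {α β c cf cg ch ε : ℝ} {f g h : V → ℝ}

/-- The interior edges of the subdivision cancel in pairs by antisymmetry, and the half edges on the
boundary combine by midpoint additivity. -/
lemma refine_bdry (hK : Convex ℝ K) {a : V → V → ℝ}
    (hsymm : ∀ p ∈ K, ∀ q ∈ K, a q p = -a p q)
    (hmid : ∀ p ∈ K, ∀ q ∈ K, a p (midpoint ℝ p q) + a (midpoint ℝ p q) q = a p q) :
    ∀ x, InTri K x → refine triCh (bdry a) x = bdry a x := by
  rintro ⟨p, q, r⟩ ⟨hp, hq, hr⟩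
  have m1 := hK.midpoint_mem hp hq
  have m2 := hK.midpoint_mem hp hr
  have m3 := hK.midpoint_mem hq hr
  have h1 := hmid p hp q hq
  have h2 := hmid p hp r hr
  have h3 := hmid q hq r hr
  have s1 := hsymm _ m1 _ m2
  have s2 := hsymm _ m1 _ m3
  have s3 := hsymm _ m2 _ m3
  rw [refine_triCh]
  simp only [bdry]
  linarith

lemma refine_bdry_young (hK : Convex ℝ K) (hβ : 1 / 2 < β) (hβ1 : β ≤ 1) (hg : IsHolder β g K)
    (hh : IsHolder β h K) : ∀ x, InTri K x →
      refine triCh (bdry (young g h)) x = bdry (young g h) x :=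
  refine_bdry hK (fun _ hp _ hq => young_symm hK hβ hβ1 hg hh hp hq)
    (fun _ hp _ hq => young_midpoint hK hβ hβ1 hg hh hp hq)

/-- The coboundary of f ∪ δg is the product (f(q) - f(p)) (g(r) - g(q)), accounting for the 1;
replacing the three edge values by Young integrals accounts for 3 `youngConst β`. -/
lemma abs_bdry_young_le (hK : Convex ℝ K) (hβ : 1 / 2 < β) (hcf : 0 ≤ cf) (hcg : 0 ≤ cg)
    (hf : HolderBound cf β f K) (hg : HolderBound cg β g K) :
    ∀ x, InTri K x →
      |bdry (young f g) x| ≤ (1 + 3 * youngConst β) * (cf * cg * perim x ^ (2 * β)) := by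
  rintro ⟨p, q, r⟩ ⟨hp, hq, hr⟩
  have hY := youngConst_nonneg hβ
  have hs := perim_nonneg (p, q, r)
  have hd : dist p q ≤ perim (p, q, r) ∧ dist q r ≤ perim (p, q, r) ∧
      dist p r ≤ perim (p, q, r) := by
    have h1 := dist_nonneg (x := p) (y := q)
    have h2 := dist_nonneg (x := q) (y := r)
    have h3 := dist_nonneg (x := p) (y := r)
    simp only [perim]
    refine ⟨?_, ?_, ?_⟩ <;> linarith
  have key : ∀ a ∈ K, ∀ b ∈ K, dist a b ≤ perim (p, q, r) →
      |young f g a b - f a * (g b - g a)| ≤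
        youngConst β * (cf * cg * perim (p, q, r) ^ (2 * β)) := by
    intro a ha b hb hab
    refine (young_near hK hβ hcf hcg hf hg ha hb).trans ?_
    gcongr
  have h1 := abs_le.1 (key q hq r hr hd.2.1)
  have h2 := abs_le.1 (key p hp r hr hd.2.2)
  have h3 := abs_le.1 (key p hp q hq hd.1)
  have h4 : |(f q - f p) * (g r - g q)| ≤ cf * cg * perim (p, q, r) ^ (2 * β) := by
    rw [abs_mul, two_mul, Real.rpow_add_of_nonneg hs (by linarith) (by linarith)]
    have i1 := hf q hq p hp
    have i2 := hg r hr q hq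
    rw [dist_comm] at i1 i2
    calc _ ≤ (cf * perim (p, q, r) ^ β) * (cg * perim (p, q, r) ^ β) := by
          refine mul_le_mul (i1.trans ?_) (i2.trans ?_) (abs_nonneg _) (by positivity)
          · have := hd.1
            gcongr
          · have := hd.2.1
            gcongr
      _ = _ := by ring
  have h5 := abs_le.1 h4
  have e : (f q - f p) * (g r - g q) =
    f q * (g r - g q) - f p * (g r - g p) + f p * (g q - g p) := by ring
  simp only [bdry]
  exact abs_le.2 ⟨by linarith, by linarith⟩

/-- The constant in the sewing estimate for Züst germs. -/
noncomputable def zustConst (β : ℝ) : ℝ := 3 * (1 + 3 * youngConst β)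

lemma zustConst_nonneg (hβ : 1 / 2 < β) : 0 ≤ zustConst β := by
  have := youngConst_nonneg hβ
  unfold zustConst
  positivity

/-- Since δ(g dh) is invariant under subdivision, only the change of base point of f contributes.
Three of the four children have a first vertex other than p, hence the factor 3 in `zustConst`. -/
lemma abs_refine_cupBdry_sub_le (hK : Convex ℝ K) (hα : 0 < α) (hβ : 1 / 2 < β) (hβ1 : β ≤ 1)
    (hcf : 0 ≤ cf) (hcg : 0 ≤ cg) (hch : 0 ≤ ch) (hf : HolderBound cf α f K)
    (hg : HolderBound cg β g K) (hh : HolderBound ch β h K) : ∀ x, InTri K x →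
      |refine triCh (cupBdry f g h) x - cupBdry f g h x| ≤
        zustConst β * cf * cg * ch * perim x ^ (α + 2 * β) := by
  rintro ⟨p, q, r⟩ hx
  obtain ⟨hp, hq, hr⟩ := id hx
  have m1 := hK.midpoint_mem hp hq
  have m2 := hK.midpoint_mem hp hr
  have m3 := hK.midpoint_mem hq hr
  have hY := youngConst_nonneg hβ
  have hs := perim_nonneg (p, q, r)
  have hadd := refine_bdry_young hK hβ hβ1 ⟨cg, hcg, hg⟩ ⟨ch, hch, hh⟩ _ hx
  have hsmall : ∀ i, |bdry (young g h) (triCh i (p, q, r))| ≤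
      (1 + 3 * youngConst β) * (cg * ch * perim (p, q, r) ^ (2 * β)) := by
    intro i
    refine (abs_bdry_young_le hK hβ hcg hch hg hh _ ((halving_triCh hK).mem i _ hx)).trans ?_
    have h1 := perim_nonneg (triCh i (p, q, r))
    have h2 : perim (triCh i (p, q, r)) ≤ perim (p, q, r) := by
      linarith [(halving_triCh hK).le i _ hx]
    gcongr
  have e1 : dist (midpoint ℝ p q) p ≤ perim (p, q, r) := by
    have h1 := dist_nonneg (x := p) (y := q)
    have h2 := dist_nonneg (x := q) (y := r)
    have h3 := dist_nonneg (x := p) (y := r)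
    rw [dist_midpoint_left]
    norm_num [perim]
    linarith
  have e2 : dist (midpoint ℝ p r) p ≤ perim (p, q, r) := by
    have h1 := dist_nonneg (x := p) (y := q)
    have h2 := dist_nonneg (x := q) (y := r)
    have h3 := dist_nonneg (x := p) (y := r)
    rw [dist_midpoint_left]
    norm_num [perim]
    linarith
  have e3 : dist (midpoint ℝ q r) p ≤ perim (p, q, r) := by
    have h1 := dist_triangle (midpoint ℝ q r) q p
    have h2 := dist_nonneg (x := q) (y := r)
    have h3 := dist_nonneg (x := p) (y := r)
    rw [dist_midpoint_left, dist_comm q p] at h1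
    norm_num [perim] at h1 ⊢
    linarith
  have term : ∀ m ∈ K, dist m p ≤ perim (p, q, r) → ∀ i,
      |(f m - f p) * bdry (young g h) (triCh i (p, q, r))| ≤
        (1 + 3 * youngConst β) * cf * cg * ch * perim (p, q, r) ^ (α + 2 * β) := by
    intro m hm hd i
    rw [abs_mul, Real.rpow_add_of_nonneg hs (by linarith) (by linarith)]
    calc _ ≤ (cf * perim (p, q, r) ^ α) *
          ((1 + 3 * youngConst β) * (cg * ch * perim (p, q, r) ^ (2 * β))) := by
          refine mul_le_mul ((hf m hm p hp).trans ?_) (hsmall i) (abs_nonneg _) (by positivity)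
          gcongr
      _ = _ := by ring
  have t1 := abs_le.1 (term _ m1 e1 1)
  have t2 := abs_le.1 (term _ m2 e2 2)
  have t3 := abs_le.1 (term _ m3 e3 3)
  have e : refine triCh (cupBdry f g h) (p, q, r) - cupBdry f g h (p, q, r) =
      (f (midpoint ℝ p q) - f p) * bdry (young g h) (triCh 1 (p, q, r)) +
      (f (midpoint ℝ p r) - f p) * bdry (young g h) (triCh 2 (p, q, r)) +
      (f (midpoint ℝ q r) - f p) * bdry (young g h) (triCh 3 (p, q, r)) := by
    rw [refine_triCh]
    simp only [cupBdry]
    rw [← hadd, refine_triCh]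
    simp only [triCh, Matrix.cons_val]
    ring
  rw [e]
  unfold zustConst
  exact abs_le.2 ⟨by linarith, by linarith⟩

lemma zust_near (hK : Convex ℝ K) (hα : 0 < α) (hβ : 1 / 2 < β) (hβ1 : β ≤ 1)
    (hαβ : 2 < α + 2 * β) (hcf : 0 ≤ cf) (hcg : 0 ≤ cg) (hch : 0 ≤ ch)
    (hf : HolderBound cf α f K) (hg : HolderBound cg β g K) (hh : HolderBound ch β h K)
    {x : V × V × V} (hx : InTri K x) :
    |zust f g h x - cupBdry f g h x| ≤
      zustConst β * cf * cg * ch * perim x ^ (α + 2 * β) / (1 - 4 / 2 ^ (α + 2 * β)) := by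
  have := zustConst_nonneg hβ
  simpa [zust] using abs_sewLim_sub_le (halving_triCh hK) (by linarith)
    (by positivity : 0 ≤ zustConst β * cf * cg * ch) (four_lt_two_rpow hαβ)
    (abs_refine_cupBdry_sub_le hK hα hβ hβ1 hcf hcg hch hf hg hh) hx

lemma tendsto_zust_of_tendsto {F G H : ℕ → V → ℝ} (hK : Convex ℝ K) (hα : 0 < α)
    (hβ : 1 / 2 < β) (hβ1 : β ≤ 1) (hαβ : 2 < α + 2 * β) (hcf : 0 ≤ cf) (hcg : 0 ≤ cg)
    (hch : 0 ≤ ch) (hF : ∀ n, HolderBound cf α (F n) K) (hG : ∀ n, HolderBound cg β (G n) K)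
    (hH : ∀ n, HolderBound ch β (H n) K)
    (hFf : ∀ x ∈ K, Tendsto (fun n => F n x) atTop (𝓝 (f x)))
    (hGg : ∀ x ∈ K, Tendsto (fun n => G n x) atTop (𝓝 (g x)))
    (hHh : ∀ x ∈ K, Tendsto (fun n => H n x) atTop (𝓝 (h x))) {x : V × V × V}
    (hx : InTri K x) : Tendsto (fun n => zust (F n) (G n) (H n) x) atTop (𝓝 (zust f g h x)) := by
  have := zustConst_nonneg hβ
  have hy : ∀ p ∈ K, ∀ q ∈ K,
      Tendsto (fun n => young (G n) (H n) p q) atTop (𝓝 (young g h p q)) := fun p hp q hq =>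
    tendsto_young_of_tendsto hK hβ hcg hch hG hH hGg hHh hp hq
  refine tendsto_sewLim_of_tendsto (halving_triCh hK) (by linarith)
    (by positivity : 0 ≤ zustConst β * cf * cg * ch) (four_lt_two_rpow hαβ)
    (fun n => abs_refine_cupBdry_sub_le hK hα hβ hβ1 hcf hcg hch (hF n) (hG n) (hH n))
    (fun x hx => ?_) hx
  exact (hFf _ hx.1).mul (((hy _ hx.2.1 _ hx.2.2).sub (hy _ hx.1 _ hx.2.2)).add
    (hy _ hx.1 _ hx.2.1))

lemma zust_comp (φ : W →ᵃ[ℝ] V) (f g h : V → ℝ) (p q r : W) :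
    zust f g h (φ p, φ q, φ r) = zust (f ∘ φ) (g ∘ φ) (h ∘ φ) (p, q, r) := by
  have := sewLim_comp (ch := triCh) (ch' := triCh)
    (Φ := fun x : W × W × W => (φ x.1, φ x.2.1, φ x.2.2))
    (triCh_map φ) (cupBdry f g h) (p, q, r)
  rw [zust, this]
  congr 1
  funext x
  simp [cupBdry, bdry, young_comp]

/-- On collinear triples δ(g dh) vanishes by additivity along the line, and subdivision keeps
triples collinear; so all the approximating sums are 0. -/
lemma zust_line (hK : Convex ℝ K) (hβ : 1 / 2 < β) (hβ1 : β ≤ 1)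
    (hg : IsHolder β g K) (hh : IsHolder β h K) (φ : ℝ →ᵃ[ℝ] V) {s t u : ℝ}
    (hx : InTri K (φ s, φ t, φ u)) : zust f g h (φ s, φ t, φ u) = 0 := by
  have hz : ∀ n, (refine triCh)^[n] (cupBdry f g h) (φ s, φ t, φ u) = 0 := by
    intro n
    rw [refine_iterate_congr (b := 0)
      (P := fun x => InTri K x ∧ ∃ s t u, x = (φ s, φ t, φ u)) ?_ ?_ n _ ⟨hx, s, t, u, rfl⟩,
      refine_iterate_zero]
    · rfl
    · rintro i x ⟨hxK, s, t, u, rfl⟩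
      refine ⟨(halving_triCh hK).mem i _ hxK, ?_⟩
      exact ⟨_, _, _, triCh_map φ i (s, t, u)⟩
    · rintro x ⟨⟨h1, h2, h3⟩, s, t, u, rfl⟩
      have := young_add_line hK hβ hβ1 hg hh φ h1 h2 h3
      have e : bdry (young g h) (φ s, φ t, φ u) = 0 := by
        simp only [bdry]
        linarith
      simp [cupBdry, e]
  refine Tendsto.limUnder_eq ?_
  simp [hz]

/-! ### Linearization of the integrators -/

/-- By Leibniz, g dh + h dg is the increment of a function, and the coboundary of such an increment
is 0. -/
lemma bdry_young_antisymm (hK : Convex ℝ K) (hβ : 1 / 2 < β) (hg : IsHolder β g K)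
    (hh : IsHolder β h K) {x : V × V × V} (hx : InTri K x) :
    bdry (young h g) x = -bdry (young g h) x := by
  have h1 := young_leibniz hK hβ hg hh hx.1 hx.2.1
  have h2 := young_leibniz hK hβ hg hh hx.1 hx.2.2
  have h3 := young_leibniz hK hβ hg hh hx.2.1 hx.2.2
  simp only [bdry]
  linarith

lemma sum_mul_antisymm {ι : Type*} [Fintype ι] [LinearOrder ι] [LocallyFiniteOrderTop ι]
    [LocallyFiniteOrderBot ι] (a b : ι → ℝ) {A : ι → ι → ℝ} (hA : ∀ i j, A j i = -A i j) :
    ∑ i, ∑ j, a i * b j * A i j = ∑ i, ∑ j ∈ Finset.Ioi i, (a i * b j - a j * b i) * A i j := by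
  have hd : ∀ i, A i i = 0 := fun i => by linarith [hA i i]
  have h1 := Finset.sum_sum_Ioi_add_eq_sum_sum_off_diag fun i j => a i * b j * A i j
  have h2 : ∑ i, ∑ j ∈ ({i}ᶜ : Finset ι), a j * b i * A j i = ∑ i, ∑ j, a i * b j * A i j := by
    rw [Finset.sum_comm (f := fun i j => a i * b j * A i j)]
    refine Finset.sum_congr rfl fun i _ => ?_
    rw [← Finset.sum_compl_add_sum {i}]
    simp [hd]
  rw [← h2, ← h1]
  refine Finset.sum_congr rfl fun i _ => Finset.sum_congr rfl fun j _ => ?_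
  rw [hA i j]
  ring

/-- With L and M the linear combinations, G dH = L dM + (G - L) dH + L d(H - M). The first term
expands bilinearly, and antisymmetry turns the coefficients into 2 × 2 minors; each of the other two
has one factor with Hölder constant ε. Used twice: for Taylor expansion in the plane, and for Ψ ∘ g
in terms of the gⁱ. -/
lemma bdry_young_linearize {ι : Type*} [Fintype ι] [LinearOrder ι] [LocallyFiniteOrderTop ι]
    [LocallyFiniteOrderBot ι] (hK : Convex ℝ K) (hβ : 1 / 2 < β) {F : ι → V → ℝ}
    (hF : ∀ i, IsHolder β (F i) K) {G H : V → ℝ} {a b : ι → ℝ} (hc : 0 ≤ c) (hε : 0 ≤ ε)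
    (hL : HolderBound c β (∑ i, a i • F i) K) (hH : HolderBound c β H K)
    (hRG : HolderBound ε β (G - ∑ i, a i • F i) K) (hRH : HolderBound ε β (H - ∑ i, b i • F i) K)
    {x : V × V × V} (hx : InTri K x) :
    |bdry (young G H) x -
        ∑ i, ∑ j ∈ Finset.Ioi i, (a i * b j - a j * b i) * bdry (young (F i) (F j)) x| ≤
      2 * (1 + 3 * youngConst β) * (c * ε * perim x ^ (2 * β)) := by
  set L := ∑ i, a i • F i with hLdef
  set M := ∑ i, b i • F i with hMdef
  have iL : IsHolder β L K := ⟨c, hc, hL⟩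
  have iH : IsHolder β H K := ⟨c, hc, hH⟩
  have iRG : IsHolder β (G - L) K := ⟨ε, hε, hRG⟩
  have iRH : IsHolder β (H - M) K := ⟨ε, hε, hRH⟩
  have iM : IsHolder β M K := IsHolder.sum_smul _ b hF
  have hsplit : ∀ p ∈ K, ∀ q ∈ K, young G H p q =
      (∑ i, ∑ j, a i * b j * young (F i) (F j) p q) + young (G - L) H p q +
        young L (H - M) p q := by
    intro p hp q hq
    have h1 := young_add_left hK hβ iL iRG iH hp hq
    have h2 := young_add_right hK hβ iL iM iRH hp hq
    rw [add_sub_cancel] at h1 h2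
    have h3 : young L M p q = ∑ i, ∑ j, a i * b j * young (F i) (F j) p q := by
      rw [hLdef, young_sum_smul_left _ a hK hβ hF iM hp hq]
      refine Finset.sum_congr rfl fun i _ => ?_
      rw [hMdef, young_sum_smul_right _ b hK hβ hF (hF i) hp hq, Finset.mul_sum]
      exact Finset.sum_congr rfl fun j _ => by ring
    rw [h1, h2, h3]
    ring
  have hb : bdry (young G H) x = (∑ i, ∑ j, a i * b j * bdry (young (F i) (F j)) x) +
      bdry (young (G - L) H) x + bdry (young L (H - M)) x := by
    simp only [bdry]
    rw [hsplit _ hx.2.1 _ hx.2.2, hsplit _ hx.1 _ hx.2.2, hsplit _ hx.1 _ hx.2.1]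
    simp only [mul_add, mul_sub, Finset.sum_add_distrib, Finset.sum_sub_distrib]
    ring
  rw [hb, sum_mul_antisymm a b (A := fun i j => bdry (young (F i) (F j)) x)
    fun i j => bdry_young_antisymm hK hβ (hF i) (hF j) hx]
  have h1 := abs_le.1 (abs_bdry_young_le hK hβ hε hc hRG hH x hx)
  have h2 := abs_le.1 (abs_bdry_young_le hK hβ hc hε hL hRH x hx)
  exact abs_le.2 ⟨by linarith, by linarith⟩

end Zust

/-! ### Züst germs are closed on planes -/

/-- The coordinates of the plane. -/
def planeCoord : Fin 2 → ℝ × ℝ → ℝ := ![Prod.fst, Prod.snd]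

/-- The gradient of a function on the plane. -/
noncomputable def planeGrad (G : ℝ × ℝ → ℝ) (p : ℝ × ℝ) : Fin 2 → ℝ :=
  ![fderiv ℝ G p (1, 0), fderiv ℝ G p (0, 1)]

lemma sum_planeGrad_smul (G : ℝ × ℝ → ℝ) (p : ℝ × ℝ) :
    ∑ i, planeGrad G p i • planeCoord i = fun x => fderiv ℝ G p x := by
  funext x
  have : x = x.1 • (1, 0) + x.2 • ((0, 1) : ℝ × ℝ) := by ext <;> simp
  conv_rhs => rw [this, map_add, map_smul, map_smul]
  simp [planeGrad, planeCoord, mul_comm]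

lemma isHolder_planeCoord (K : Set (ℝ × ℝ)) (i : Fin 2) : IsHolder 1 (planeCoord i) K := by
  refine ⟨1, zero_le_one, fun x _ y _ => ?_⟩
  rw [Real.rpow_one, one_mul, Prod.dist_eq]
  fin_cases i
  · exact le_max_left _ _
  · exact le_max_right _ _

lemma dist_le_perim_of_mem_convexHull {V : Type*} [NormedAddCommGroup V] [NormedSpace ℝ V]
    {x : V × V × V} {u : V} (hu : u ∈ convexHull ℝ {x.1, x.2.1, x.2.2}) : dist u x.1 ≤ perim x := by
  have h1 := dist_nonneg (x := x.1) (y := x.2.1)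
  have h2 := dist_nonneg (x := x.2.1) (y := x.2.2)
  have h3 := dist_nonneg (x := x.1) (y := x.2.2)
  refine convexHull_min (t := Metric.closedBall x.1 (perim x)) ?_ (convex_closedBall _ _) hu
  rintro y (rfl | rfl | rfl)
  · exact Metric.mem_closedBall_self (perim_nonneg x)
  · rw [Metric.mem_closedBall, dist_comm]
    unfold perim
    linarith
  · rw [Metric.mem_closedBall, dist_comm]
    unfold perim
    linarith

lemma inTri_convexHull {V : Type*} [NormedAddCommGroup V] [NormedSpace ℝ V] (x : V × V × V) :
    InTri (convexHull ℝ {x.1, x.2.1, x.2.2}) x :=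
  ⟨subset_convexHull ℝ _ (by simp), subset_convexHull ℝ _ (by simp),
    subset_convexHull ℝ _ (by simp)⟩

lemma InTri.convexHull_subset {V : Type*} [NormedAddCommGroup V] [NormedSpace ℝ V] {K : Set V}
    {x : V × V × V} (hx : InTri K x) (hK : Convex ℝ K) :
    convexHull ℝ {x.1, x.2.1, x.2.2} ⊆ K := by
  refine convexHull_min ?_ hK
  rintro y (rfl | rfl | rfl)
  exacts [hx.1, hx.2.1, hx.2.2]

/-- One constant dominates the Lipschitz constant of G, the norm of dG and the Lipschitz constant of
dG on K. The remainder is estimated only on the hull of the triangle, where dG varies by at most c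
times the perimeter. -/
lemma exists_linear_holderBound {G : ℝ × ℝ → ℝ} (hG : ContDiff ℝ 2 G) {K : Set (ℝ × ℝ)}
    (hK : Convex ℝ K) (hKc : IsCompact K) : ∃ c, 0 ≤ c ∧ HolderBound c 1 G K ∧ ∀ x, InTri K x →
      HolderBound c 1 (∑ i, planeGrad G x.1 i • planeCoord i) K ∧
      HolderBound (c * perim x) 1 (G - ∑ i, planeGrad G x.1 i • planeCoord i)
        (convexHull ℝ {x.1, x.2.1, x.2.2}) := by
  have hd : Differentiable ℝ G := hG.differentiable (by norm_num)
  have hG' : ContDiff ℝ 1 (fderiv ℝ G) := hG.fderiv_right (by norm_num)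
  obtain ⟨c₁, hc₁, h₁⟩ := exists_holderBound_one (hG.of_le (by norm_num)) hKc
  obtain ⟨c₂, hc₂⟩ := hKc.exists_bound_of_continuousOn hG'.continuous.continuousOn
  obtain ⟨c₃, hc₃⟩ :=
    hG'.locallyLipschitz.locallyLipschitzOn.exists_lipschitzOnWith_of_compact hKc
  refine ⟨max c₁ (max c₂ c₃), le_max_of_le_left hc₁, h₁.weaken (le_max_left _ _),
    fun x hx => ⟨fun u hu v hv => ?_, fun u hu v hv => ?_⟩⟩
  · rw [sum_planeGrad_smul, ← map_sub, Real.rpow_one, dist_eq_norm, ← Real.norm_eq_abs]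
    refine ((fderiv ℝ G x.1).le_opNorm _).trans ?_
    have := (hc₂ _ hx.1).trans ((le_max_left c₂ (c₃ : ℝ)).trans (le_max_right c₁ _))
    gcongr
  · rw [sum_planeGrad_smul, Real.rpow_one, dist_eq_norm, ← Real.norm_eq_abs]
    refine Convex.norm_image_sub_le_of_norm_hasFDerivWithin_le
      (f' := fun w => fderiv ℝ G w - fderiv ℝ G x.1)
      (fun w _ => ((hd w).hasFDerivAt.sub (fderiv ℝ G x.1).hasFDerivAt).hasFDerivWithinAt)
      (fun w hw => ?_) (convex_convexHull ℝ _) hv hu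
    have hsub := hx.convexHull_subset hK
    have h2 := hc₃.dist_le_mul w (hsub hw) x.1 hx.1
    rw [dist_eq_norm] at h2
    have h3 := dist_le_perim_of_mem_convexHull hw
    have h4 : (c₃ : ℝ) ≤ max c₁ (max c₂ c₃) := (le_max_right _ _).trans (le_max_right _ _)
    have h5 := perim_nonneg x
    exact h2.trans (by gcongr)

lemma sum_Ioi_fin_two (F : Fin 2 → Fin 2 → ℝ) : ∑ i, ∑ j ∈ Finset.Ioi i, F i j = F 0 1 := by
  have h0 : Finset.Ioi (0 : Fin 2) = {1} := by decide
  have h1 : Finset.Ioi (1 : Fin 2) = ∅ := by decide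
  simp [Fin.sum_univ_two, h0, h1]

/-- To first order dG ∧ dH is the Jacobian at the base vertex times the form dx ∧ dy. The error has
order 3, beyond the threshold 2 for sewing on triangles. -/
lemma exists_bdry_young_near_jacobian {G H : ℝ × ℝ → ℝ} (hG : ContDiff ℝ 2 G)
    (hH : ContDiff ℝ 2 H) {K : Set (ℝ × ℝ)} (hK : Convex ℝ K) (hKc : IsCompact K) :
    ∃ C, 0 ≤ C ∧ ∀ x, InTri K x →
      |bdry (young G H) x - (planeGrad G x.1 0 * planeGrad H x.1 1 -
        planeGrad G x.1 1 * planeGrad H x.1 0) * bdry (young Prod.fst Prod.snd) x| ≤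
        C * perim x ^ (3 : ℝ) := by
  obtain ⟨c, hc, hGc, hG'⟩ := exists_linear_holderBound hG hK hKc
  obtain ⟨c', hc', hHc, hH'⟩ := exists_linear_holderBound hH hK hKc
  have hY := youngConst_nonneg (β := 1) (by norm_num)
  refine ⟨2 * (1 + 3 * youngConst 1) * (max c c' * max c c'), by positivity, fun x hx => ?_⟩
  have hs := perim_nonneg x
  have hsub := hx.convexHull_subset hK
  have := bdry_young_linearize (β := 1) (c := max c c') (ε := max c c' * perim x)
    (convex_convexHull ℝ {x.1, x.2.1, x.2.2}) (by norm_num)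
    (isHolder_planeCoord _) (by positivity) (by positivity)
    (((hG' x hx).1.mono hsub).weaken (le_max_left _ _)) ((hHc.mono hsub).weaken (le_max_right _ _))
    ((hG' x hx).2.weaken (by gcongr; exact le_max_left _ _))
    ((hH' x hx).2.weaken (by gcongr; exact le_max_right _ _)) (inTri_convexHull x)
  rw [sum_Ioi_fin_two] at this
  refine this.trans (le_of_eq ?_)
  rw [show (3 : ℝ) = 1 + 2 * 1 by norm_num, Real.rpow_add_of_nonneg hs (by norm_num) (by norm_num),
    Real.rpow_one]
  ring

/-- On the plane, the Züst germ of smooth functions is exact. -/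
lemma zust_closed_of_contDiff {f g h : ℝ × ℝ → ℝ} (hf : ContDiff ℝ 3 f) (hg : ContDiff ℝ 3 g)
    (hh : ContDiff ℝ 3 h) (p q r t : ℝ × ℝ) :
    zust f g h (q, r, t) - zust f g h (p, r, t) + zust f g h (p, q, t) - zust f g h (p, q, r)
      = 0 := by
  have hg2 : ContDiff ℝ 2 (fderiv ℝ g) := hg.fderiv_right (by norm_num)
  have hh2 : ContDiff ℝ 2 (fderiv ℝ h) := hh.fderiv_right (by norm_num)
  have hf2 : ContDiff ℝ 2 f := hf.of_le (by norm_num)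
  -- Choosing ∂ₓA = f · (Jacobian of (g, h)) makes d(A dy) = f dg ∧ dh.
  obtain ⟨A, hA, hAF⟩ := exists_contDiff_antideriv_fst
    (F := fun p => f p * (planeGrad g p 0 * planeGrad h p 1 - planeGrad g p 1 * planeGrad h p 0))
    (by simp only [planeGrad, Matrix.cons_val]; fun_prop)
  let K : Set (ℝ × ℝ) := convexHull ℝ {p, q, r, t}
  have hK : Convex ℝ K := convex_convexHull ℝ _
  have hKc : IsCompact K := (Set.toFinite {p, q, r, t}).isCompact_convexHull ℝ
  have hsub : {p, q, r, t} ⊆ K := subset_convexHull ℝ _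
  obtain ⟨C₁, hC₁, h₁⟩ := exists_bdry_young_near_jacobian (hg.of_le (by norm_num))
    (hh.of_le (by norm_num)) hK hKc
  obtain ⟨C₂, hC₂, h₂⟩ := exists_bdry_young_near_jacobian hA
    (contDiff_snd : ContDiff ℝ 2 (Prod.snd : ℝ × ℝ → ℝ)) hK hKc
  obtain ⟨M, hM⟩ := hKc.exists_bound_of_continuousOn hf.continuous.continuousOn
  have hM0 : 0 ≤ M := (norm_nonneg _).trans (hM p (hsub (by simp)))
  -- Both δ(A dy) and f ∪ δ(g dh) agree with f times the Jacobian at the base vertex times δ(x dy),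
  -- up to order 3. As δ(A dy) is invariant under subdivision, it is the sewing; closedness is then
  -- δδ = 0.
  have key : ∀ x, InTri K x → zust f g h x = bdry (young A Prod.snd) x := by
    intro x hx
    refine sewLim_eq (halving_triCh hK) (γ := 3) (C := C₂ + M * C₁) (by norm_num) (by positivity)
      (four_lt_two_rpow (by norm_num)) (refine_bdry_young hK (β := 1) (by norm_num) le_rfl
        (exists_holderBound_one (hA.of_le (by norm_num)) hKc)
        (isHolder_planeCoord K 1 : IsHolder 1 Prod.snd K))
      (fun x hx => ?_) hx
    have e1 := h₁ x hx
    have e2 := h₂ x hx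
    have hsnd : planeGrad Prod.snd x.1 0 = 0 ∧ planeGrad Prod.snd x.1 1 = 1 := by
      simp [planeGrad, fderiv_snd]
    have hA0 : planeGrad A x.1 0 = f x.1 * (planeGrad g x.1 0 * planeGrad h x.1 1 -
        planeGrad g x.1 1 * planeGrad h x.1 0) := hAF x.1
    rw [hsnd.1, hsnd.2, hA0] at e2
    have e3 := mul_le_mul (hM _ hx.1) e1 (abs_nonneg _) hM0
    rw [Real.norm_eq_abs, ← abs_mul] at e3
    have e4 : bdry (young A Prod.snd) x - cupBdry f g h x =
        (bdry (young A Prod.snd) x - (f x.1 * (planeGrad g x.1 0 * planeGrad h x.1 1 -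
          planeGrad g x.1 1 * planeGrad h x.1 0) * 1 - planeGrad A x.1 1 * 0) *
          bdry (young Prod.fst Prod.snd) x) -
        f x.1 * (bdry (young g h) x - (planeGrad g x.1 0 * planeGrad h x.1 1 -
          planeGrad g x.1 1 * planeGrad h x.1 0) * bdry (young Prod.fst Prod.snd) x) := by
      simp only [cupBdry]
      ring
    change |bdry (young A Prod.snd) x - cupBdry f g h x| ≤ _
    rw [e4]
    refine (abs_sub _ _).trans ?_
    rw [add_mul, mul_assoc M]
    exact add_le_add e2 e3
  have hp : p ∈ K := hsub (by simp)
  have hq : q ∈ K := hsub (by simp)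
  have hr : r ∈ K := hsub (by simp)
  have ht : t ∈ K := hsub (by simp)
  rw [key _ ⟨hq, hr, ht⟩, key _ ⟨hp, hr, ht⟩, key _ ⟨hp, hq, ht⟩, key _ ⟨hp, hq, hr⟩]
  simp only [bdry]
  ring

/-- Mollify all three functions with uniform Hölder constants on K and pass to the limit in the
smooth identity. -/
lemma zust_closed_real_prod {K : Set (ℝ × ℝ)} {α β : ℝ} {f g h : ℝ × ℝ → ℝ} (hK : Convex ℝ K)
    (hα : 0 < α) (hα1 : α ≤ 1) (hβ : 1 / 2 < β) (hβ1 : β ≤ 1) (hαβ : 2 < α + 2 * β)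
    (hf : IsHolder α f K) (hg : IsHolder β g K) (hh : IsHolder β h K) {p q r t : ℝ × ℝ}
    (hp : p ∈ K) (hq : q ∈ K) (hr : r ∈ K) (ht : t ∈ K) :
    zust f g h (q, r, t) - zust f g h (p, r, t) + zust f g h (p, q, t) - zust f g h (p, q, r)
      = 0 := by
  obtain ⟨cf, hcf, hf⟩ := hf
  obtain ⟨cg, hcg, hg⟩ := hg
  obtain ⟨ch, hch, hh⟩ := hh
  obtain ⟨F, hF, hFh, hFf⟩ := hf.exists_smooth_approx ⟨p, hp⟩ hcf hα hα1
  obtain ⟨G, hG, hGh, hGg⟩ := hg.exists_smooth_approx ⟨p, hp⟩ hcg (by linarith) hβ1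
  obtain ⟨H, hH, hHh, hHl⟩ := hh.exists_smooth_approx ⟨p, hp⟩ hch (by linarith) hβ1
  have hlim : ∀ {a b c}, a ∈ K → b ∈ K → c ∈ K → Tendsto
      (fun n => zust (F n) (G n) (H n) (a, b, c)) atTop (𝓝 (zust f g h (a, b, c))) :=
    fun ha hb hc => tendsto_zust_of_tendsto hK hα hβ hβ1 hαβ hcf hcg hch hFh hGh hHh hFf hGg hHl
      ⟨ha, hb, hc⟩
  have := (((hlim hq hr ht).sub (hlim hp hr ht)).add (hlim hp hq ht)).sub (hlim hp hq hr)
  simp only [zust_closed_of_contDiff (hF _) (hG _) (hH _)] at this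
  exact tendsto_nhds_unique this tendsto_const_nhds

lemma zust_closed_plane {V : Type*} [NormedAddCommGroup V] [NormedSpace ℝ V] {K : Set V}
    {α β : ℝ} {f g h : V → ℝ} (hK : Convex ℝ K) (hα : 0 < α) (hα1 : α ≤ 1) (hβ : 1 / 2 < β)
    (hβ1 : β ≤ 1) (hαβ : 2 < α + 2 * β) (hf : IsHolder α f K) (hg : IsHolder β g K)
    (hh : IsHolder β h K) (φ : ℝ × ℝ →ᵃ[ℝ] V) {p q r t : ℝ × ℝ}
    (hp : φ p ∈ K) (hq : φ q ∈ K) (hr : φ r ∈ K) (ht : φ t ∈ K) :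
    zust f g h (φ q, φ r, φ t) - zust f g h (φ p, φ r, φ t) + zust f g h (φ p, φ q, φ t) -
      zust f g h (φ p, φ q, φ r) = 0 := by
  simp only [zust_comp]
  exact zust_closed_real_prod (hK.affine_preimage φ) hα hα1 hβ hβ1 hαβ
    (hf.comp_affine hα.le φ) (hg.comp_affine (by linarith) φ) (hh.comp_affine (by linarith) φ)
    hp hq hr ht

end RoughForm

noncomputable section

namespace RoughForm

open Filter Topology

variable {d k : ℕ} {D : Set (E d)}

/-! ### Simplices as tuples of points -/

lemma convexHull_range_subset {K : Set (E d)} (hK : Convex ℝ K) {n : ℕ} {p : Fin n → E d}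
    (hp : ∀ i, p i ∈ K) : convexHull ℝ (Set.range p) ⊆ K :=
  convexHull_min (by rintro _ ⟨i, rfl⟩; exact hp i) hK

namespace Simp

/-- The simplex with given vertices in a convex subset of `D`. -/
def mk' {K : Set (E d)} (hK : Convex ℝ K) (hKD : K ⊆ D) (p : Fin (k + 1) → E d)
    (hp : ∀ i, p i ∈ K) : Simp k D := ⟨p, (convexHull_range_subset hK hp).trans hKD⟩

/-- The convex envelope of a simplex. -/
def hull (S : Simp k D) : Set (E d) := convexHull ℝ (Set.range S.1)

lemma convex_hull (S : Simp k D) : Convex ℝ S.hull := convex_convexHull ℝ _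

lemma hull_subset (S : Simp k D) : S.hull ⊆ D := S.2

lemma mem_hull (S : Simp k D) (i : Fin (k + 1)) : S.1 i ∈ S.hull :=
  subset_convexHull ℝ _ ⟨i, rfl⟩

lemma dist_le_diam (S : Simp k D) (i j : Fin (k + 1)) : dist (S.1 i) (S.1 j) ≤ S.diam :=
  Metric.dist_le_diam_of_mem (Set.finite_range _).isBounded ⟨i, rfl⟩ ⟨j, rfl⟩

lemma diam_nonneg (S : Simp k D) : 0 ≤ S.diam := Metric.diam_nonneg

lemma Isometric.diam_eq {S T : Simp k D} (h : S.Isometric T) : S.diam = T.diam := by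
  obtain ⟨ι, hι, h⟩ := h
  have : T.1 = ι ∘ S.1 := funext fun j => (h j).symm
  rw [diam, diam, this, Set.range_comp, hι.diam_image]

lemma diam_shrink_le (S : Simp k D) (n : ℕ) : (S.shrink n).diam ≤ (2 : ℝ)⁻¹ ^ n * S.diam := by
  have h0 := S.diam_nonneg
  refine Metric.diam_le_of_forall_dist_le (by positivity) ?_
  rintro _ ⟨i, rfl⟩ _ ⟨j, rfl⟩
  simp only [shrink]
  rw [dist_add_left, dist_smul₀, dist_sub_right, Real.norm_of_nonneg (by positivity)]
  gcongr
  exact S.dist_le_diam i j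

/-- The halved image of a simplex under a homothety or a point reflection is isometric to its
dyadic shrinking. -/
lemma isometric_shrink {S T : Simp k D} {ε : ℝ} (hε : |ε| = 1)
    (h : ∀ j, T.1 j - T.1 0 = (ε / 2) • (S.1 j - S.1 0)) (n : ℕ) :
    (S.shrink (n + 1)).Isometric (T.shrink n) := by
  refine ⟨fun x => T.1 0 + ε • (x - S.1 0), Isometry.of_dist_eq fun x y => ?_, fun j => ?_⟩
  · rw [dist_add_left, dist_smul₀, dist_sub_right, Real.norm_eq_abs, hε, one_mul]
  · simp only [shrink]
    rw [h j, add_sub_cancel_left, smul_smul, smul_smul]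
    congr 2
    rw [pow_succ]
    ring

lemma shrink_zero (S : Simp k D) : S.shrink 0 = S := by
  refine Subtype.ext (funext fun j => ?_)
  simp [shrink]

end Simp

/-! ### Dini gauges and uniqueness of regular germs -/

namespace Germ

lemma IsDini.add {r : ℝ} {u v : Germ k D} (hu : IsDini r u) (hv : IsDini r v) :
    IsDini r (u + v) where
  nonneg S := add_nonneg (hu.nonneg S) (hv.nonneg S)
  uniform S T h := congrArg₂ (· + ·) (hu.uniform S T h) (hv.uniform S T h)
  tendsto S := by simpa [mul_add] using (hu.tendsto S).add (hv.tendsto S)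

lemma IsDini.smul {r : ℝ} {u : Germ k D} (hu : IsDini r u) {c : ℝ} (hc : 0 ≤ c) :
    IsDini r (c • u) where
  nonneg S := mul_nonneg hc (hu.nonneg S)
  uniform S T h := congrArg (c * ·) (hu.uniform S T h)
  tendsto S := by simpa [mul_left_comm] using (hu.tendsto S).const_mul c

lemma isDini_diam_rpow {r γ : ℝ} (hγ0 : 0 ≤ γ) (hγ : r < γ) :
    IsDini r (fun S : Simp k D => S.diam ^ γ) where
  nonneg S := Real.rpow_nonneg S.diam_nonneg _
  uniform S T h := by rw [h.diam_eq]
  tendsto S := by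
    have hlt : (2 : ℝ) ^ (r - γ) < 1 := Real.rpow_lt_one_of_one_lt_of_neg (by norm_num) (by linarith)
    have hgeo : Tendsto (fun n : ℕ => S.diam ^ γ * ((2 : ℝ) ^ (r - γ)) ^ n) atTop (𝓝 0) := by
      simpa using (tendsto_pow_atTop_nhds_zero_of_lt_one (by positivity) hlt).const_mul
        (S.diam ^ γ)
    refine squeeze_zero (fun n => ?_) (fun n => ?_) hgeo
    · have := (S.shrink n).diam_nonneg
      positivity
    · have h0 := (S.shrink n).diam_nonneg
      have h1 := S.diam_nonneg
      calc (2 : ℝ) ^ ((n : ℝ) * r) * (S.shrink n).diam ^ γ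
          ≤ (2 : ℝ) ^ ((n : ℝ) * r) * ((2 : ℝ)⁻¹ ^ n * S.diam) ^ γ := by
            gcongr
            exact S.diam_shrink_le n
        _ = S.diam ^ γ * ((2 : ℝ) ^ (r - γ)) ^ n := by
            rw [Real.mul_rpow (by positivity) h1, ← Real.rpow_natCast, ← Real.rpow_natCast,
              ← Real.rpow_neg_one, ← Real.rpow_mul (by norm_num), ← Real.rpow_mul (by norm_num),
              ← Real.rpow_mul (by norm_num), ← mul_assoc, ← Real.rpow_add (by norm_num), mul_comm]
            congr 2
            ring

/-- After n subdivisions there are 2^{kn} cells, each isometric to the shrunken simplex because ε =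
±1 is an isometry. Uniformity of the gauge bounds |ζ| by 2^{nk} u(2⁻ⁿS), which tends to 0. -/
lemma eq_zero_of_isDini {ι : Type*} [Fintype ι] {ch : ι → Simp k D → Simp k D}
    (hcard : Fintype.card ι = 2 ^ k)
    (hch : ∀ i S, ∃ ε : ℝ, |ε| = 1 ∧
      ∀ j, (ch i S).1 j - (ch i S).1 0 = (ε / 2) • (S.1 j - S.1 0))
    {ζ u : Germ k D} (hζ : ∀ S, refine ch ζ S = ζ S) (hu : IsDini k u) (h : ∀ S, |ζ S| ≤ u S) :
    ζ = 0 := by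
  have key : ∀ (n : ℕ) (S : Simp k D), |ζ S| ≤ (2 : ℝ) ^ ((n : ℝ) * k) * u (S.shrink n) := by
    intro n
    induction n with
    | zero => intro S; simpa [Simp.shrink_zero] using h S
    | succ n ih =>
      intro S
      rw [← hζ S]
      calc |refine ch ζ S| ≤ ∑ i, |ζ (ch i S)| := Finset.abs_sum_le_sum_abs _ _
        _ ≤ ∑ _i : ι, (2 : ℝ) ^ ((n : ℝ) * k) * u (S.shrink (n + 1)) := by
            refine Finset.sum_le_sum fun i _ => (ih (ch i S)).trans ?_
            obtain ⟨ε, hε, hj⟩ := hch i S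
            rw [hu.uniform _ _ (Simp.isometric_shrink hε hj n)]
        _ = _ := by
            rw [Finset.sum_const, Finset.card_univ, hcard, nsmul_eq_mul, ← mul_assoc]
            congr 1
            push_cast
            rw [← Real.rpow_natCast, ← Real.rpow_add (by norm_num)]
            congr 1
            ring
  funext S
  have := ge_of_tendsto' (hu.tendsto S) fun n => key n S
  exact abs_eq_zero.1 (le_antisymm this (abs_nonneg _))

lemma IsRegular.sub {η η' : Germ k D} (h : IsRegular η) (h' : IsRegular η') :
    IsRegular (η - η') where
  nonatomic S hS := by simp [h.nonatomic S hS, h'.nonatomic S hS]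
  closed I φ hφ := by
    have e : delta (pullback φ hφ (η - η')) =
        delta (pullback φ hφ η) - delta (pullback φ hφ η') := by
      funext S
      simp [delta, pullback, mul_sub]
    rw [e, h.closed, h'.closed, sub_zero]

lemma IsRegular.delta_eq_zero {ω : Germ k D} (h : IsRegular ω) {S : Simp (k + 1) D}
    (φ : E k →ᵃ[ℝ] E d) {t : Fin (k + 2) → E k} (ht : ∀ j, φ (t j) = S.1 j) :
    delta ω S = 0 := by
  have hφt : φ ∘ t = S.1 := funext ht
  -- The whole preimage of D serves as the domain of the affine map, so no separate choice is
  -- needed.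
  let T : Simp (k + 1) (φ ⁻¹' D) := ⟨t, by
    rw [← Set.image_subset_iff, AffineMap.image_convexHull, ← Set.range_comp, hφt]
    exact S.2⟩
  have := congrFun (h.closed (φ ⁻¹' D) φ fun _ hx => hx) T
  refine Eq.trans (Finset.sum_congr rfl fun i _ => ?_) this
  congr 2
  exact Subtype.ext (funext fun j => (ht _).symm)

lemma exists_isDini_of_near {ω η η' : Germ k D} (h : IsSew ω η) (h' : IsSew ω η') :
    ∃ u : Germ k D, IsDini k u ∧ ∀ S, |(η - η') S| ≤ u S := by
  obtain ⟨_, v, hv, c, hc⟩ := h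
  obtain ⟨_, v', hv', c', hc'⟩ := h'
  refine ⟨|c| • v + |c'| • v', (hv.smul (abs_nonneg c)).add (hv'.smul (abs_nonneg c')),
    fun S => ?_⟩
  have h1 := abs_le.1 ((hc S).trans (mul_le_mul_of_nonneg_right (le_abs_self c) (hv.nonneg S)))
  have h2 := abs_le.1 ((hc' S).trans (mul_le_mul_of_nonneg_right (le_abs_self c') (hv'.nonneg S)))
  simp only [Pi.sub_apply, Pi.add_apply, Pi.smul_apply, smul_eq_mul] at h1 h2 ⊢
  exact abs_le.2 ⟨by linarith, by linarith⟩

lemma delta_one_apply (ω : Germ 1 D) (S : Simp 2 D) :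
    delta ω S = ω (S.face 0) - ω (S.face 1) + ω (S.face 2) := by
  simp [delta, Fin.sum_univ_three]
  ring

lemma delta_two_apply (ω : Germ 2 D) (S : Simp 3 D) :
    delta ω S = ω (S.face 0) - ω (S.face 1) + ω (S.face 2) - ω (S.face 3) := by
  simp [delta, Fin.sum_univ_four]
  ring

end Germ

namespace Simp

/-- The vertices of a `1`-simplex. -/
def pair (S : Simp 1 D) : E d × E d := (S.1 0, S.1 1)

/-- The vertices of a `2`-simplex. -/
def tri (S : Simp 2 D) : E d × E d × E d := (S.1 0, S.1 1, S.1 2)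

lemma inTri (S : Simp 2 D) : InTri S.hull S.tri := ⟨S.mem_hull 0, S.mem_hull 1, S.mem_hull 2⟩

lemma perim_tri_le (S : Simp 2 D) : perim S.tri ≤ 3 * S.diam := by
  have h1 := S.dist_le_diam 0 1
  have h2 := S.dist_le_diam 1 2
  have h3 := S.dist_le_diam 0 2
  simp only [perim, tri]
  linarith

/-- The `1`-simplex `[p q]`. -/
def ofPair {K : Set (E d)} (hK : Convex ℝ K) (hKD : K ⊆ D) (x : E d × E d)
    (hx : x.1 ∈ K ∧ x.2 ∈ K) : Simp 1 D :=
  mk' hK hKD ![x.1, x.2] (by simpa [Fin.forall_fin_two] using hx)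

/-- The `2`-simplex `[p q r]`. -/
def ofTri {K : Set (E d)} (hK : Convex ℝ K) (hKD : K ⊆ D) (x : E d × E d × E d)
    (hx : InTri K x) : Simp 2 D :=
  mk' hK hKD ![x.1, x.2.1, x.2.2] (by simpa [Fin.forall_fin_succ, InTri] using hx)

/-- The halves of a `1`-simplex. -/
def segChild (i : Fin 2) (S : Simp 1 D) : Simp 1 D :=
  ofPair S.convex_hull S.hull_subset (segCh i S.pair)
    ((halving_segCh S.convex_hull).mem i S.pair ⟨S.mem_hull 0, S.mem_hull 1⟩)

/-- The four triangles of the dyadic subdivision of a `2`-simplex. -/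
def triChild (i : Fin 4) (S : Simp 2 D) : Simp 2 D :=
  ofTri S.convex_hull S.hull_subset (triCh i S.tri) ((halving_triCh S.convex_hull).mem i _ S.inTri)

lemma segChild_homothetic (i : Fin 2) (S : Simp 1 D) : ∃ ε : ℝ, |ε| = 1 ∧
    ∀ j, (segChild i S).1 j - (segChild i S).1 0 = (ε / 2) • (S.1 j - S.1 0) := by
  refine ⟨1, abs_one, fun j => ?_⟩
  fin_cases i <;> fin_cases j <;>
    simp [segChild, ofPair, mk', segCh, pair, midpoint_eq_smul_add] <;> module

/-- The middle triangle, listed from the midpoint opposite the first vertex, is a half-size point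
reflection; this is why ε = -1 must be allowed. -/
lemma triChild_homothetic (i : Fin 4) (S : Simp 2 D) : ∃ ε : ℝ, |ε| = 1 ∧
    ∀ j, (triChild i S).1 j - (triChild i S).1 0 = (ε / 2) • (S.1 j - S.1 0) := by
  refine ⟨![1, 1, 1, -1] i, by fin_cases i <;> simp, fun j => ?_⟩
  fin_cases i <;> fin_cases j <;>
    simp [triChild, ofTri, mk', triCh, tri, midpoint_eq_smul_add] <;> module

/-! ### Volume -/

lemma vol_eq (S : Simp k D) : S.vol = 1 / (k.factorial : ℝ) * Real.sqrt
    (Matrix.of fun i j : Fin k =>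
      inner ℝ (S.1 i.succ - S.1 0) (S.1 j.succ - S.1 0)).det := by
  have e : (Matrix.of fun (i : Fin k) (j : Fin d) => S.1 i.succ j - S.1 0 j) *
      (Matrix.of fun (i : Fin k) (j : Fin d) => S.1 i.succ j - S.1 0 j).transpose =
      Matrix.of fun i j => inner ℝ (S.1 i.succ - S.1 0) (S.1 j.succ - S.1 0) := by
    ext i j
    simp [Matrix.mul_apply, PiLp.inner_apply, mul_comm]
  rw [vol, e]

lemma eq_of_vol_eq_zero {S : Simp 1 D} (h : S.vol = 0) : S.1 1 = S.1 0 := by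
  rw [vol_eq] at h
  simp [Matrix.det_unique] at h
  exact sub_eq_zero.1 (by simpa using h)

/-- Equality case of Cauchy–Schwarz for the Gram determinant. Since `Real.sqrt` vanishes on all
nonpositive numbers, only the inequality det ≤ 0 is available, and it suffices. -/
lemma vol_two_eq_zero_iff (S : Simp 2 D) : S.vol = 0 ↔
    ∃ (φ : ℝ →ᵃ[ℝ] E d) (s t u : ℝ), S.1 0 = φ s ∧ S.1 1 = φ t ∧ S.1 2 = φ u := by
  rw [vol_eq, Matrix.det_fin_two, mul_eq_zero, or_iff_right (by positivity)]
  simp only [Matrix.of_apply]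
  change √(inner ℝ (S.1 1 - S.1 0) (S.1 1 - S.1 0) * inner ℝ (S.1 2 - S.1 0) (S.1 2 - S.1 0) -
    inner ℝ (S.1 1 - S.1 0) (S.1 2 - S.1 0) * inner ℝ (S.1 2 - S.1 0) (S.1 1 - S.1 0)) = 0 ↔ _
  constructor
  · intro h
    rw [Real.sqrt_eq_zero'] at h
    by_cases hw : S.1 2 = S.1 0
    · exact ⟨AffineMap.lineMap (S.1 0) (S.1 1), 0, 1, 0, by simp, by simp, by simp [hw]⟩
    set u := S.1 1 - S.1 0 with hu
    set w := S.1 2 - S.1 0 with hw'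
    have hww : 0 < inner ℝ w w := by
      rw [real_inner_self_eq_norm_sq]
      have : w ≠ 0 := sub_ne_zero.2 hw
      positivity
    -- The coefficient of the orthogonal projection of u to w: the squared norm of u - c w is the
    -- Gram determinant divided by |w|².
    set c := inner ℝ u w / inner ℝ w w with hc
    have hz : inner ℝ (u - c • w) (u - c • w) ≤ 0 := by
      have e : inner ℝ (u - c • w) (u - c • w) =
          (inner ℝ u u * inner ℝ w w - inner ℝ u w * inner ℝ w u) / inner ℝ w w := by
        simp only [inner_sub_left, inner_sub_right, inner_smul_left, inner_smul_right,
          real_inner_comm u w, hc, RCLike.conj_to_real]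
        field_simp
        ring
      rw [e]
      exact div_nonpos_of_nonpos_of_nonneg h hww.le
    have huw : u = c • w := by
      rw [← sub_eq_zero, ← inner_self_eq_zero (𝕜 := ℝ)]
      exact le_antisymm hz real_inner_self_nonneg
    refine ⟨AffineMap.lineMap (S.1 0) (S.1 2), 0, c, 1, by simp, ?_, by simp⟩
    rw [AffineMap.lineMap_apply, vsub_eq_sub, ← hw', ← huw, hu]
    simp
  · rintro ⟨φ, s, t, u, h0, h1, h2⟩
    have e : ∀ a b : ℝ, φ a - φ b = (a - b) • φ.linear 1 := fun a b => by
      rw [← vsub_eq_sub, ← φ.linearMap_vsub, vsub_eq_sub, ← map_smul, smul_eq_mul, mul_one]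
    rw [h0, h1, h2, e, e]
    simp only [inner_smul_left, inner_smul_right]
    rw [Real.sqrt_eq_zero']
    apply le_of_eq
    simp
    ring

end Simp

/-! ### Dyadic invariance of regular germs and uniqueness of sewings -/

namespace Germ

/-- The coordinate of a one-dimensional Euclidean space. -/
def lineCoord : E 1 →ₗ[ℝ] ℝ := (EuclideanSpace.proj (0 : Fin 1) : E 1 →L[ℝ] ℝ).toLinearMap

/-- The coordinates of a two-dimensional Euclidean space. -/
def planeCoords : E 2 →ₗ[ℝ] ℝ × ℝ :=
  ((EuclideanSpace.proj (0 : Fin 2) : E 2 →L[ℝ] ℝ).toLinearMap).prod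
    (EuclideanSpace.proj (1 : Fin 2) : E 2 →L[ℝ] ℝ).toLinearMap

/-- The inverse of `lineCoord`. -/
def ofLine : ℝ →ₗ[ℝ] E 1 := LinearMap.toSpanSingleton ℝ (E 1) (EuclideanSpace.single 0 1)

/-- The inverse of `planeCoords`. -/
def ofPlane : ℝ × ℝ →ₗ[ℝ] E 2 :=
  (LinearMap.fst ℝ ℝ ℝ).smulRight (EuclideanSpace.single 0 1) +
    (LinearMap.snd ℝ ℝ ℝ).smulRight (EuclideanSpace.single 1 1)

lemma ofLine_lineCoord (x : E 1) : ofLine (lineCoord x) = x := by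
  ext i
  fin_cases i
  simp [ofLine, lineCoord]

lemma lineCoord_ofLine (s : ℝ) : lineCoord (ofLine s) = s := by simp [ofLine, lineCoord]

lemma ofPlane_planeCoords (x : E 2) : ofPlane (planeCoords x) = x := by
  ext i
  fin_cases i <;> simp [ofPlane, planeCoords]

lemma planeCoords_ofPlane (s : ℝ × ℝ) : planeCoords (ofPlane s) = s := by
  ext <;> simp [ofPlane, planeCoords]

lemma IsRegular.delta_eq_zero_of_line {ω : Germ 1 D} (h : IsRegular ω) {S : Simp 2 D}
    (ψ : ℝ →ᵃ[ℝ] E d) {s : Fin 3 → ℝ} (hs : ∀ j, ψ (s j) = S.1 j) : delta ω S = 0 :=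
  h.delta_eq_zero (ψ.comp lineCoord.toAffineMap) (t := fun j => ofLine (s j)) fun j => by
    simp [lineCoord_ofLine, hs]

lemma IsRegular.delta_eq_zero_of_plane {ω : Germ 2 D} (h : IsRegular ω) {S : Simp 3 D}
    (ψ : ℝ × ℝ →ᵃ[ℝ] E d) {s : Fin 4 → ℝ × ℝ} (hs : ∀ j, ψ (s j) = S.1 j) : delta ω S = 0 :=
  h.delta_eq_zero (ψ.comp planeCoords.toAffineMap) (t := fun j => ofPlane (s j)) fun j => by
    simp [planeCoords_ofPlane, hs]

lemma IsRegular.refine_segChild {ζ : Germ 1 D} (h : IsRegular ζ) (S : Simp 1 D) :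
    refine Simp.segChild ζ S = ζ S := by
  let T : Simp 2 D := Simp.mk' S.convex_hull S.hull_subset
    ![S.1 0, midpoint ℝ (S.1 0) (S.1 1), S.1 1] (by
      have := S.convex_hull.midpoint_mem (S.mem_hull 0) (S.mem_hull 1)
      simpa [Fin.forall_fin_succ, S.mem_hull] using this)
  have h0 : delta ζ T = 0 := by
    refine h.delta_eq_zero_of_line (AffineMap.lineMap (S.1 0) (S.1 1)) (s := ![0, ⅟2, 1])
      fun j => ?_
    fin_cases j
    · simp [T, Simp.mk']
    · rfl
    · simp [T, Simp.mk']
  rw [delta_one_apply] at h0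
  have e0 : T.face 0 = Simp.segChild 1 S := by
    refine Subtype.ext (funext fun j => ?_)
    fin_cases j <;> rfl
  have e1 : T.face 1 = S := by
    refine Subtype.ext (funext fun j => ?_)
    fin_cases j <;> rfl
  have e2 : T.face 2 = Simp.segChild 0 S := by
    refine Subtype.ext (funext fun j => ?_)
    fin_cases j <;> rfl
  rw [e0, e1, e2] at h0
  rw [refine, Fin.sum_univ_two]
  linarith

/-- The plane through the vertices of a triangle. -/
def planeThrough (p q r : E d) : ℝ × ℝ →ᵃ[ℝ] E d :=
  ((LinearMap.fst ℝ ℝ ℝ).smulRight (q - p) + (LinearMap.snd ℝ ℝ ℝ).smulRight (r - p)).toAffineMap +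
    AffineMap.const ℝ (ℝ × ℝ) p

lemma exists_planeThrough_eq (S : Simp 2 D) {x : E d} (hx : x ∈ S.hull) :
    ∃ s, planeThrough (S.1 0) (S.1 1) (S.1 2) s = x := by
  have hconv : Convex ℝ (Set.range (planeThrough (S.1 0) (S.1 1) (S.1 2))) := by
    rw [← Set.image_univ]
    exact convex_univ.affine_image _
  refine convexHull_range_subset hconv (fun i => ?_) hx
  fin_cases i
  · exact ⟨(0, 0), by simp [planeThrough]⟩
  · exact ⟨(1, 0), by simp [planeThrough]⟩
  · exact ⟨(0, 1), by simp [planeThrough]⟩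

-- A Poincaré lemma on the triangle: coning from its first vertex writes the germ as the coboundary
-- of a 1-germ, to which `refine_bdry` applies.
open Classical in
lemma IsRegular.refine_triChild {ζ : Germ 2 D} (h : IsRegular ζ) (S : Simp 2 D) :
    refine Simp.triChild ζ S = ζ S := by
  have hK := S.convex_hull
  let Z : E d × E d × E d → ℝ := fun x =>
    if hx : InTri S.hull x then ζ (Simp.ofTri hK S.hull_subset x hx) else 0
  have hZ : ∀ {x} (hx : InTri S.hull x), Z x = ζ (Simp.ofTri hK S.hull_subset x hx) :=
    fun hx => dif_pos hx
  have closed : ∀ {a b c e}, a ∈ S.hull → b ∈ S.hull → c ∈ S.hull → e ∈ S.hull →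
      Z (b, c, e) - Z (a, c, e) + Z (a, b, e) - Z (a, b, c) = 0 := by
    intro a b c e ha hb hc he
    let T : Simp 3 D := Simp.mk' hK S.hull_subset ![a, b, c, e]
      (by simp [Fin.forall_fin_succ, ha, hb, hc, he])
    obtain ⟨sa, hsa⟩ := exists_planeThrough_eq S ha
    obtain ⟨sb, hsb⟩ := exists_planeThrough_eq S hb
    obtain ⟨sc, hsc⟩ := exists_planeThrough_eq S hc
    obtain ⟨se, hse⟩ := exists_planeThrough_eq S he
    have h0 : delta ζ T = 0 := h.delta_eq_zero_of_plane
      (planeThrough (S.1 0) (S.1 1) (S.1 2)) (s := ![sa, sb, sc, se]) fun j => by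
        fin_cases j
        exacts [hsa, hsb, hsc, hse]
    rw [delta_two_apply] at h0
    rw [hZ ⟨hb, hc, he⟩, hZ ⟨ha, hc, he⟩, hZ ⟨ha, hb, he⟩, hZ ⟨ha, hb, hc⟩, ← h0]
    congr 4 <;> refine Subtype.ext (funext fun j => ?_) <;> fin_cases j <;> rfl
  have degen : ∀ (φ : ℝ →ᵃ[ℝ] E d) (s t u : ℝ), InTri S.hull (φ s, φ t, φ u) →
      Z (φ s, φ t, φ u) = 0 := by
    intro φ s t u hx
    rw [hZ hx]
    exact h.nonatomic _ ((Simp.vol_two_eq_zero_iff _).2 ⟨φ, s, t, u, rfl, rfl, rfl⟩)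
  have hp := S.mem_hull 0
  -- The cone potential. Closedness on (p₀, x, y, z) gives ζ = δa; on (p₀, x, y, x) and (p₀, x, m,
  -- y), with m the midpoint of x and y, combined with vanishing on collinear triples, it gives
  -- antisymmetry and midpoint additivity of `a`.
  let a : E d → E d → ℝ := fun x y => Z (S.1 0, x, y)
  have hbdry : ∀ x, InTri S.hull x → Z x = bdry a x := by
    rintro ⟨x, y, z⟩ ⟨hx, hy, hz⟩
    have := closed hp hx hy hz
    simp only [bdry, a]
    linarith
  have hline : ∀ x ∈ S.hull, ∀ y ∈ S.hull, ∀ s t u : ℝ,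
      AffineMap.lineMap x y s ∈ S.hull → AffineMap.lineMap x y t ∈ S.hull →
      AffineMap.lineMap x y u ∈ S.hull →
      Z (AffineMap.lineMap x y s, AffineMap.lineMap x y t, AffineMap.lineMap x y u) = 0 :=
    fun x _ y _ s t u h1 h2 h3 => degen _ s t u ⟨h1, h2, h3⟩
  have key := refine_bdry hK (a := a)
    (fun x hx y hy => by
      have h1 := closed hp hx hy hx
      have h2 := hline x hx y hy 0 1 0 (by simpa) (by simpa) (by simpa)
      have h3 := hline _ hp x hx 0 1 1 (by simpa) (by simpa) (by simpa)
      simp only [AffineMap.lineMap_apply_zero, AffineMap.lineMap_apply_one] at h2 h3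
      simp only [a]
      linarith)
    (fun x hx y hy => by
      have hm := hK.midpoint_mem hx hy
      have h1 := closed hp hx hm hy
      have h2 := hline x hx y hy 0 ⅟2 1 (by simpa) hm (by simpa)
      simp only [AffineMap.lineMap_apply_zero, AffineMap.lineMap_apply_one] at h2
      change Z (x, midpoint ℝ x y, y) = 0 at h2
      simp only [a]
      linarith) S.tri S.inTri
  have e0 : ζ S = Z S.tri := by
    rw [hZ S.inTri]
    congr 1
    refine Subtype.ext (funext fun j => ?_)
    fin_cases j <;> rfl
  rw [e0, hbdry _ S.inTri, ← key]
  refine Finset.sum_congr rfl fun i _ => ?_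
  rw [← hbdry _ ((halving_triCh hK).mem i _ S.inTri), hZ ((halving_triCh hK).mem i _ S.inTri)]
  rfl

lemma IsSew.unique_one {ω η η' : Germ 1 D} (h : IsSew ω η) (h' : IsSew ω η') : η = η' := by
  obtain ⟨u, hu, hle⟩ := exists_isDini_of_near h h'
  exact sub_eq_zero.1 (eq_zero_of_isDini (by simp) Simp.segChild_homothetic
    (h.1.sub h'.1).refine_segChild hu hle)

lemma IsSew.unique_two {ω η η' : Germ 2 D} (h : IsSew ω η) (h' : IsSew ω η') : η = η' := by
  obtain ⟨u, hu, hle⟩ := exists_isDini_of_near h h'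
  exact sub_eq_zero.1 (eq_zero_of_isDini (by simp) Simp.triChild_homothetic
    (h.1.sub h'.1).refine_triChild hu hle)

lemma isSew_sew {ω : Germ k D} (h : Sewable ω) : IsSew ω (sew ω) := by
  rw [sew, dif_pos h]
  exact h.choose_spec

lemma IsSew.sew_one {ω η : Germ 1 D} (h : IsSew ω η) : sew ω = η :=
  (isSew_sew ⟨η, h⟩).unique_one h

lemma IsSew.sew_two {ω η : Germ 2 D} (h : IsSew ω η) : sew ω = η :=
  (isSew_sew ⟨η, h⟩).unique_two h

/-! ### `0`-germs as functions on the ambient space -/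

open Classical in
/-- The function on the ambient space that extends a `0`-germ by zero. -/
def hat (f : Germ 0 D) : E d → ℝ := fun x =>
  if h : x ∈ D then f ⟨fun _ => x, by simpa using h⟩ else 0

lemma apply_vertex (f : Germ 0 D) (S : Simp k D) (i : Fin (k + 1)) :
    f (S.vertex i) = hat f (S.1 i) := by
  rw [hat, dif_pos (S.hull_subset (S.mem_hull i))]
  rfl

lemma delta_zero_apply (f : Germ 0 D) (S : Simp 1 D) :
    delta f S = hat f (S.1 1) - hat f (S.1 0) := by
  rw [← apply_vertex, ← apply_vertex]
  have e0 : S.face 0 = S.vertex 1 := by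
    refine Subtype.ext (funext fun j => ?_)
    fin_cases j; rfl
  have e1 : S.face 1 = S.vertex 0 := by
    refine Subtype.ext (funext fun j => ?_)
    fin_cases j; rfl
  simp [delta, e0, e1, sub_eq_add_neg]

/-- `f` is `α`-Hölder on the convex subsets of `D`, with a common constant. -/
def HolderOnConvex (α : ℝ) (D : Set (E d)) (f : E d → ℝ) : Prop :=
  ∃ c, 0 ≤ c ∧ ∀ K, Convex ℝ K → K ⊆ D → HolderBound c α f K

lemma HolderOnConvex.isHolder {α : ℝ} {f : E d → ℝ} (h : HolderOnConvex α D f) {K : Set (E d)}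
    (hK : Convex ℝ K) (hKD : K ⊆ D) : IsHolder α f K := by
  obtain ⟨c, hc, h⟩ := h
  exact ⟨c, hc, h K hK hKD⟩

lemma Holder.holderOnConvex {α : ℝ} {f : Germ 0 D} (hf : Holder α f) :
    HolderOnConvex α D (hat f) := by
  obtain ⟨c, hc⟩ := hf
  refine ⟨|c|, abs_nonneg c, fun K hK hKD x hx y hy => ?_⟩
  let T := Simp.ofPair hK hKD (x, y) ⟨hx, hy⟩
  have := hc T
  have hd : T.diam = dist x y := by
    simp [T, Simp.diam, Simp.ofPair, Simp.mk', Matrix.range_cons, Metric.diam_pair, dist_comm]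
  rw [delta_zero_apply] at this
  change |hat f y - hat f x| ≤ c * T.diam ^ α at this
  rw [hd, abs_sub_comm] at this
  exact this.trans (by gcongr; exact le_abs_self c)

/-- At distances up to 1 a smaller exponent is weaker; at larger distances boundedness takes over.
-/
lemma HolderOnConvex.of_le {α α' M : ℝ} {f : E d → ℝ} (hf : HolderOnConvex α D f)
    (hM : ∀ x ∈ D, |f x| ≤ M) (hα' : 0 ≤ α') (hα : α' ≤ α) : HolderOnConvex α' D f := by
  obtain ⟨c, hc, hf⟩ := hf
  refine ⟨max c (2 * M), le_max_of_le_left hc, fun K hK hKD x hx y hy => ?_⟩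
  rcases le_total (dist x y) 1 with h1 | h1
  · refine (hf K hK hKD x hx y hy).trans ?_
    rcases (dist_nonneg (x := x) (y := y)).eq_or_lt with h0 | h0
    · have : x = y := dist_eq_zero.1 h0.symm
      subst this
      -- Coincident points need care because the real power 0 ^ 0 is 1.
      rcases hα'.eq_or_lt with h2 | h2
      · subst h2
        have := Real.zero_rpow_le_one α
        simp only [dist_self, Real.rpow_zero, mul_one]
        exact (mul_le_of_le_one_right hc this).trans (le_max_left _ _)
      · simp [Real.zero_rpow h2.ne', Real.zero_rpow (h2.trans_le hα).ne']
    · have := Real.rpow_le_rpow_of_exponent_ge h0 h1 hα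
      gcongr
      exact le_max_left _ _
  · have h2 := Real.one_le_rpow h1 hα'
    have h3 : |f x - f y| ≤ 2 * M :=
      (abs_sub _ _).trans (by linarith [hM x (hKD hx), hM y (hKD hy)])
    calc |f x - f y| ≤ max c (2 * M) * 1 := by rw [mul_one]; exact h3.trans (le_max_right _ _)
      _ ≤ _ := by gcongr

lemma Bounded.exists_hat_le {f : Germ 0 D} (hf : Bounded f) : ∃ M, 0 ≤ M ∧ ∀ x, |hat f x| ≤ M := by
  obtain ⟨M, hM⟩ := hf
  refine ⟨|M|, abs_nonneg M, fun x => ?_⟩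
  unfold hat
  split_ifs
  · exact (hM _).trans (le_abs_self M)
  · simp

/-! ### Young and Züst germs are sewings -/

/-- The Young germ `f dg`. -/
def youngGerm (f g : Germ 0 D) : Germ 1 D := fun S => young (hat f) (hat g) (S.1 0) (S.1 1)

/-- The Züst germ `f dg ∧ dh`. -/
def zustGerm (f g h : Germ 0 D) : Germ 2 D := fun S => zust (hat f) (hat g) (hat h) S.tri

variable {f g h : Germ 0 D} {α β : ℝ}

lemma delta_youngGerm (f g : Germ 0 D) (S : Simp 2 D) :
    delta (youngGerm f g) S = bdry (young (hat f) (hat g)) S.tri := by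
  rw [delta_one_apply]
  rfl

lemma isSew_youngGerm (hβ : 1 / 2 < β) (hβ1 : β ≤ 1) (hf : HolderOnConvex β D (hat f))
    (hg : HolderOnConvex β D (hat g)) : IsSew (cup f (delta g)) (youngGerm f g) := by
  refine ⟨⟨fun S hS => ?_, fun I φ hφ => ?_⟩, fun S => S.diam ^ (2 * β),
    isDini_diam_rpow (by linarith) (by push_cast; linarith), ?_⟩
  · rw [youngGerm, Simp.eq_of_vol_eq_zero hS]
    exact young_self S.convex_hull hβ hβ1 (hf.isHolder S.convex_hull S.hull_subset)
      (hg.isHolder S.convex_hull S.hull_subset) (S.mem_hull 0)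
  · funext T
    let S := T.map φ hφ
    let ψ : ℝ →ᵃ[ℝ] E d := φ.comp ofLine.toAffineMap
    have e : ∀ j, S.1 j = ψ (lineCoord (T.1 j)) := fun j => by
      simp [ψ, ofLine_lineCoord, S, Simp.map]
    have := young_add_line S.convex_hull hβ hβ1 (hf.isHolder S.convex_hull S.hull_subset)
      (hg.isHolder S.convex_hull S.hull_subset) ψ (e 0 ▸ S.mem_hull 0) (e 1 ▸ S.mem_hull 1)
      (e 2 ▸ S.mem_hull 2)
    rw [← e, ← e, ← e] at this
    rw [delta_one_apply]
    change young (hat f) (hat g) (S.1 1) (S.1 2) - young (hat f) (hat g) (S.1 0) (S.1 2) +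
      young (hat f) (hat g) (S.1 0) (S.1 1) = 0
    linarith
  · obtain ⟨cf, hcf, hf⟩ := hf
    obtain ⟨cg, hcg, hg⟩ := hg
    refine ⟨youngConst β * (cf * cg), fun S => ?_⟩
    have := young_near S.convex_hull hβ hcf hcg (hf _ S.convex_hull S.hull_subset)
      (hg _ S.convex_hull S.hull_subset) (S.mem_hull 0) (S.mem_hull 1)
    have hY := youngConst_nonneg hβ
    rw [Pi.sub_apply, cup, delta_zero_apply, apply_vertex f, abs_sub_comm]
    refine this.trans ?_
    change _ ≤ youngConst β * (cf * cg) * S.diam ^ (2 * β)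
    rw [mul_assoc (youngConst β)]
    have := S.dist_le_diam 0 1
    gcongr

lemma isSew_zustGerm (hα : 0 < α) (hα1 : α ≤ 1) (hβ : 1 / 2 < β) (hβ1 : β ≤ 1)
    (hαβ : 2 < α + 2 * β) (hf : HolderOnConvex α D (hat f)) (hg : HolderOnConvex β D (hat g))
    (hh : HolderOnConvex β D (hat h)) :
    IsSew (cup f (delta (youngGerm g h))) (zustGerm f g h) := by
  refine ⟨⟨fun S hS => ?_, fun I φ hφ => ?_⟩, fun S => S.diam ^ (α + 2 * β),
    isDini_diam_rpow (by linarith) (by push_cast; linarith), ?_⟩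
  · obtain ⟨φ, s, t, u, h0, h1, h2⟩ := (Simp.vol_two_eq_zero_iff S).1 hS
    have hx := S.inTri
    rw [zustGerm]
    simp only [Simp.tri, h0, h1, h2] at hx ⊢
    exact zust_line S.convex_hull hβ hβ1 (hg.isHolder S.convex_hull S.hull_subset)
      (hh.isHolder S.convex_hull S.hull_subset) φ hx
  · funext T
    let S := T.map φ hφ
    let ψ : ℝ × ℝ →ᵃ[ℝ] E d := φ.comp ofPlane.toAffineMap
    have e : ∀ j, S.1 j = ψ (planeCoords (T.1 j)) := fun j => by
      simp [ψ, ofPlane_planeCoords, S, Simp.map]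
    have := zust_closed_plane S.convex_hull hα hα1 hβ hβ1 hαβ
      (hf.isHolder S.convex_hull S.hull_subset)
      (hg.isHolder S.convex_hull S.hull_subset) (hh.isHolder S.convex_hull S.hull_subset) ψ
      (e 0 ▸ S.mem_hull 0) (e 1 ▸ S.mem_hull 1) (e 2 ▸ S.mem_hull 2) (e 3 ▸ S.mem_hull 3)
    rw [← e, ← e, ← e, ← e] at this
    rw [delta_two_apply]
    exact this
  · obtain ⟨cf, hcf, hf⟩ := hf
    obtain ⟨cg, hcg, hg⟩ := hg
    obtain ⟨ch, hch, hh⟩ := hh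
    -- The power of 3 converts perimeter to diameter; the denominator is the sum of the geometric
    -- series.
    refine ⟨zustConst β * cf * cg * ch * 3 ^ (α + 2 * β) / (1 - 4 / 2 ^ (α + 2 * β)),
      fun S => ?_⟩
    have := zust_near S.convex_hull hα hβ hβ1 hαβ hcf hcg hch (hf _ S.convex_hull S.hull_subset)
      (hg _ S.convex_hull S.hull_subset) (hh _ S.convex_hull S.hull_subset) S.inTri
    have hY := zustConst_nonneg hβ
    have hd : 0 < 1 - (4 : ℝ) / 2 ^ (α + 2 * β) := by
      have := card_div_lt_one (four_lt_two_rpow hαβ)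
      simp only [Fintype.card_fin, Nat.cast_ofNat] at this
      linarith
    rw [Pi.sub_apply, cup, delta_youngGerm, apply_vertex f, abs_sub_comm]
    refine this.trans ?_
    rw [div_mul_eq_mul_div, mul_assoc (zustConst β * cf * cg * ch),
      ← Real.mul_rpow (by norm_num) S.diam_nonneg]
    have h1 := S.perim_tri_le
    have h2 := perim_nonneg S.tri
    gcongr

/-- `sew` is defined by choice; uniqueness makes it computable. -/
lemma integ_eq_youngGerm (hβ : 1 / 2 < β) (hβ1 : β ≤ 1) (hf : HolderOnConvex β D (hat f))
    (hg : HolderOnConvex β D (hat g)) : integ f g = youngGerm f g :=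
  (isSew_youngGerm hβ hβ1 hf hg).sew_one

lemma wedge_eq_zustGerm (hα : 0 < α) (hα1 : α ≤ 1) (hβ : 1 / 2 < β) (hβ1 : β ≤ 1)
    (hαβ : 2 < α + 2 * β) (hf : HolderOnConvex α D (hat f)) (hg : HolderOnConvex β D (hat g))
    (hh : HolderOnConvex β D (hat h)) : wedge f g h = zustGerm f g h := by
  rw [wedge, integ_eq_youngGerm hβ hβ1 hg hh]
  exact (isSew_zustGerm hα hα1 hβ hβ1 hαβ hf hg hh).sew_two

lemma wedgeIntegrable_of_holder (hα : 0 < α) (hα1 : α ≤ 1) (hβ : 1 / 2 < β) (hβ1 : β ≤ 1)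
    (hαβ : 2 < α + 2 * β) (hf : HolderOnConvex α D (hat f)) (hg : HolderOnConvex β D (hat g))
    (hh : HolderOnConvex β D (hat h)) : WedgeIntegrable f g h := by
  refine ⟨⟨_, isSew_youngGerm hβ hβ1 hg hh⟩, ?_⟩
  rw [integ_eq_youngGerm hβ hβ1 hg hh]
  exact ⟨_, isSew_zustGerm hα hα1 hβ hβ1 hαβ hf hg hh⟩

end Germ

variable {l : ℕ}

namespace Germ

/-! ### Stability of sewings -/

lemma IsRegular.add {η η' : Germ k D} (h : IsRegular η) (h' : IsRegular η') :
    IsRegular (η + η') where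
  nonatomic S hS := by simp [h.nonatomic S hS, h'.nonatomic S hS]
  closed I φ hφ := by
    have e : delta (pullback φ hφ (η + η')) =
        delta (pullback φ hφ η) + delta (pullback φ hφ η') := by
      funext S
      simp [delta, pullback, mul_add, Finset.sum_add_distrib]
    rw [e, h.closed, h'.closed, add_zero]

lemma isSew_zero : IsSew (0 : Germ k D) 0 := by
  refine ⟨⟨fun _ _ => rfl, fun I φ hφ => ?_⟩, 0, ⟨fun _ => le_rfl, fun _ _ _ => rfl, fun S => ?_⟩,
    0, fun S => ?_⟩
  · funext S
    simp [delta, pullback]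
  · simp
  · simp

lemma IsSew.add {ω ω' η η' : Germ k D} (h : IsSew ω η) (h' : IsSew ω' η') :
    IsSew (ω + ω') (η + η') := by
  obtain ⟨hη, v, hv, c, hc⟩ := h
  obtain ⟨hη', v', hv', c', hc'⟩ := h'
  refine ⟨hη.add hη', |c| • v + |c'| • v', (hv.smul (abs_nonneg c)).add (hv'.smul (abs_nonneg c')),
    1, fun S => ?_⟩
  have h1 := (hc S).trans (mul_le_mul_of_nonneg_right (le_abs_self c) (hv.nonneg S))
  have h2 := (hc' S).trans (mul_le_mul_of_nonneg_right (le_abs_self c') (hv'.nonneg S))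
  rw [one_mul, add_sub_add_comm]
  exact (abs_add_le _ _).trans (add_le_add h1 h2)

lemma IsSew.sum {ι : Type*} (t : Finset ι) {ω η : ι → Germ k D} (h : ∀ i ∈ t, IsSew (ω i) (η i)) :
    IsSew (∑ i ∈ t, ω i) (∑ i ∈ t, η i) := by
  classical
  induction t using Finset.induction_on with
  | empty => simpa using isSew_zero
  | insert i t hi ih =>
    rw [Finset.sum_insert hi, Finset.sum_insert hi]
    exact (h i (by simp)).add (ih fun j hj => h j (by simp [hj]))

/-- A perturbation bounded by a Dini gauge does not change the sewing. This absorbs the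
linearization error in the chain rule. -/
lemma IsSew.of_near {ω ω' η u : Germ k D} (h : IsSew ω η) (hu : IsDini k u)
    (hle : ∀ S, |ω' S - ω S| ≤ u S) : IsSew ω' η := by
  obtain ⟨hη, v, hv, c, hc⟩ := h
  refine ⟨hη, u + |c| • v, hu.add (hv.smul (abs_nonneg c)), 1, fun S => ?_⟩
  have h1 := (hc S).trans (mul_le_mul_of_nonneg_right (le_abs_self c) (hv.nonneg S))
  rw [one_mul, ← sub_add_sub_cancel ω' ω η]
  exact (abs_add_le _ _).trans (add_le_add (hle S) h1)

/-! ### Algebra of Hölder functions -/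

lemma HolderOnConvex.congr {α : ℝ} {f f' : E d → ℝ} (hf : HolderOnConvex α D f)
    (h : ∀ x ∈ D, f' x = f x) : HolderOnConvex α D f' := by
  obtain ⟨c, hc, hf⟩ := hf
  refine ⟨c, hc, fun K hK hKD x hx y hy => ?_⟩
  rw [h x (hKD hx), h y (hKD hy)]
  exact hf K hK hKD x hx y hy

lemma HolderOnConvex.sub {α : ℝ} {f f' : E d → ℝ} (hf : HolderOnConvex α D f)
    (hf' : HolderOnConvex α D f') : HolderOnConvex α D (f - f') := by
  obtain ⟨c, hc, hf⟩ := hf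
  obtain ⟨c', hc', hf'⟩ := hf'
  exact ⟨c + c', by positivity, fun K hK hKD => (hf K hK hKD).sub (hf' K hK hKD)⟩

lemma HolderOnConvex.mul {α M M' : ℝ} {f f' : E d → ℝ} (hf : HolderOnConvex α D f)
    (hf' : HolderOnConvex α D f') (hM0 : 0 ≤ M) (hM0' : 0 ≤ M') (hM : ∀ x, |f x| ≤ M)
    (hM' : ∀ x, |f' x| ≤ M') : HolderOnConvex α D (f * f') := by
  obtain ⟨c, hc, hf⟩ := hf
  obtain ⟨c', hc', hf'⟩ := hf'
  refine ⟨M * c' + M' * c, by positivity, fun K hK hKD x hx y hy => ?_⟩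
  have e : (f * f') x - (f * f') y = f x * (f' x - f' y) + f' y * (f x - f y) := by
    simp only [Pi.mul_apply]
    ring
  rw [e, add_mul, mul_assoc, mul_assoc]
  refine (abs_add_le _ _).trans (add_le_add ?_ ?_)
  · rw [abs_mul]
    exact mul_le_mul (hM x) (hf' K hK hKD x hx y hy) (abs_nonneg _) hM0
  · rw [abs_mul]
    exact mul_le_mul (hM' y) (hf K hK hKD x hx y hy) (abs_nonneg _) hM0'

end Germ

/-! ### Differentiable maps with Hölder derivative -/

lemma eq_sum_smul_single (v : E l) : v = ∑ i, v i • EuclideanSpace.single i (1 : ℝ) := by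
  ext j
  simp [Pi.single_apply]

lemma euclidean_norm_le_sum (v : E l) : ‖v‖ ≤ ∑ i, |v i| := by
  calc ‖v‖ = ‖∑ i, v i • EuclideanSpace.single i (1 : ℝ)‖ := by rw [← eq_sum_smul_single]
    _ ≤ ∑ i, ‖v i • EuclideanSpace.single i (1 : ℝ)‖ := norm_sum_le _ _
    _ = _ := by simp [norm_smul]

lemma sum_smul_apply_single (L : E l →L[ℝ] ℝ) (v : E l) :
    L v = ∑ i, v i * L (EuclideanSpace.single i 1) := by
  conv_lhs => rw [eq_sum_smul_single v]
  simp

lemma IsC1Holder.exists_fderiv_holder {n : ℕ} {σ : ℝ} {Ψ : E l → E n} (h : IsC1Holder σ Ψ) :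
    ∃ C, 0 ≤ C ∧ ∀ m x y, ‖fderiv ℝ (fun z => Ψ z m) y - fderiv ℝ (fun z => Ψ z m) x‖ ≤
      C * ‖y - x‖ ^ σ := by
  choose c hc using h.2
  refine ⟨∑ m, ∑ i, |c m i|, by positivity, fun m x y => ?_⟩
  refine ContinuousLinearMap.opNorm_le_bound _ (by positivity) fun v => ?_
  rw [sum_smul_apply_single, Real.norm_eq_abs]
  calc |∑ i, v i * (fderiv ℝ (fun z => Ψ z m) y - fderiv ℝ (fun z => Ψ z m) x)
          (EuclideanSpace.single i 1)|
      ≤ ∑ i, ‖v‖ * (|c m i| * ‖y - x‖ ^ σ) := by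
        refine (Finset.abs_sum_le_sum_abs _ _).trans (Finset.sum_le_sum fun i _ => ?_)
        rw [abs_mul]
        refine mul_le_mul (PiLp.norm_apply_le v i) ?_ (abs_nonneg _) (norm_nonneg _)
        exact (hc m i x y).trans (by gcongr; exact le_abs_self _)
    _ = (∑ i, |c m i|) * ‖y - x‖ ^ σ * ‖v‖ := by
        rw [← Finset.mul_sum, ← Finset.sum_mul, mul_comm]
    _ ≤ _ := by
        gcongr
        exact Finset.single_le_sum (f := fun m => ∑ i, |c m i|) (fun _ _ => by positivity)
          (Finset.mem_univ m)

lemma IsC1Holder.differentiable {n : ℕ} {σ : ℝ} {Ψ : E l → E n} (h : IsC1Holder σ Ψ) (m : Fin n) :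
    Differentiable ℝ fun z => Ψ z m := by
  have h1 := h.1.differentiable (by norm_num)
  fun_prop

namespace Germ

/-- The map into `ℝˡ` with components `gⁱ`. -/
def hatMap (g : Fin l → Germ 0 D) (x : E d) : E l := WithLp.toLp 2 fun i => hat (g i) x

lemma hat_comp (F : E l → ℝ) (g : Fin l → Germ 0 D) {x : E d} (hx : x ∈ D) :
    hat (comp F g) x = F (hatMap g x) := by
  simp [hat, comp, hatMap, hx]

lemma hat_mul (f f' : Germ 0 D) : hat (f * f') = hat f * hat f' := by
  funext x
  by_cases hx : x ∈ D
  · simp only [hat, Pi.mul_apply, dif_pos hx]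
    rfl
  · simp [hat, hx]

lemma exists_hatMap_holder {β : ℝ} {g : Fin l → Germ 0 D}
    (hg : ∀ i, HolderOnConvex β D (hat (g i))) : ∃ C, 0 ≤ C ∧ ∀ K, Convex ℝ K → K ⊆ D →
      ∀ x ∈ K, ∀ y ∈ K, ‖hatMap g x - hatMap g y‖ ≤ C * dist x y ^ β := by
  choose c hc hg using hg
  refine ⟨∑ i, c i, Finset.sum_nonneg fun i _ => hc i, fun K hK hKD x hx y hy => ?_⟩
  rw [Finset.sum_mul]
  refine (euclidean_norm_le_sum _).trans (Finset.sum_le_sum fun i _ => ?_)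
  exact hg i K hK hKD x hx y hy

lemma exists_hatMap_bound {g : Fin l → Germ 0 D} (hg : ∀ i, Bounded (g i)) :
    ∃ R, 0 ≤ R ∧ ∀ x, ‖hatMap g x‖ ≤ R := by
  choose M hM0 hM using fun i => (hg i).exists_hat_le
  exact ⟨∑ i, M i, Finset.sum_nonneg fun i _ => hM0 i, fun x =>
    (euclidean_norm_le_sum _).trans (Finset.sum_le_sum fun i _ => hM i x)⟩

/-! ### The chain rule -/

/-- The derivative grows at most like its Hölder modulus from 0; summing over m makes the bound
uniform in the component. -/
lemma exists_fderiv_bound {n : ℕ} {σ : ℝ} {Ψ : E l → E n} (hσ : 0 ≤ σ) (hΨ : IsC1Holder σ Ψ)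
    {R : ℝ} (hR : 0 ≤ R) : ∃ B, 0 ≤ B ∧ ∀ m x, ‖x‖ ≤ R →
      ‖fderiv ℝ (fun z => Ψ z m) x‖ ≤ B := by
  obtain ⟨C, hC, h⟩ := hΨ.exists_fderiv_holder
  refine ⟨∑ m, ‖fderiv ℝ (fun z => Ψ z m) 0‖ + C * R ^ σ, by positivity, fun m x hx => ?_⟩
  have h1 := h m 0 x
  rw [sub_zero] at h1
  have h2 : C * ‖x‖ ^ σ ≤ C * R ^ σ := by gcongr
  have h3 := Finset.single_le_sum (f := fun m => ‖fderiv ℝ (fun z => Ψ z m) 0‖)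
    (fun _ _ => by positivity) (Finset.mem_univ m)
  have h4 := norm_le_norm_add_norm_sub' (fderiv ℝ (fun z => Ψ z m) x)
    (fderiv ℝ (fun z => Ψ z m) 0)
  simp only at h3
  linarith

section ChainRule

variable {α β σ : ℝ} {f : Germ 0 D} {g : Fin l → Germ 0 D}

/-- Since g is bounded its values lie in a ball, where Ψ is Lipschitz; so composition keeps the
exponent β. -/
lemma holderOnConvex_hat_comp {n : ℕ} {Ψ : E l → E n} (hσ : 0 ≤ σ) (hΨ : IsC1Holder σ Ψ)
    (hg : ∀ i, HolderOnConvex β D (hat (g i))) (hgb : ∀ i, Bounded (g i)) (m : Fin n) :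
    HolderOnConvex β D (hat (comp (fun x => Ψ x m) g)) := by
  obtain ⟨C, hC, hg⟩ := exists_hatMap_holder hg
  obtain ⟨R, hR, hgR⟩ := exists_hatMap_bound hgb
  obtain ⟨B, hB, hBb⟩ := exists_fderiv_bound hσ hΨ hR
  refine ⟨B * C, by positivity, fun K hK hKD x hx y hy => ?_⟩
  rw [hat_comp _ g (hKD hx), hat_comp _ g (hKD hy), ← Real.norm_eq_abs]
  refine ((convex_closedBall (0 : E l) R).norm_image_sub_le_of_norm_fderiv_le (𝕜 := ℝ)
    (f := fun z => Ψ z m) (C := B) (fun z _ => hΨ.differentiable m z)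
    (fun z hz => hBb m z (by simpa using hz)) (by simpa using hgR y)
    (by simpa using hgR x)).trans ?_
  rw [mul_assoc]
  exact mul_le_mul_of_nonneg_left (hg K hK hKD x hx y hy) hB

lemma holderOnConvex_partialDeriv {n : ℕ} {Ψ : E l → E n} (hσ : 0 ≤ σ) (hΨ : IsC1Holder σ Ψ)
    (hg : ∀ i, HolderOnConvex β D (hat (g i))) (m : Fin n) (i : Fin l) :
    HolderOnConvex (σ * β) D fun x => partialDeriv Ψ m i (hatMap g x) := by
  obtain ⟨C, hC, hg⟩ := exists_hatMap_holder hg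
  obtain ⟨c, hc⟩ := hΨ.2 m i
  refine ⟨|c| * C ^ σ, by positivity, fun K hK hKD x hx y hy => ?_⟩
  refine (hc _ _).trans ?_
  rw [mul_assoc, mul_comm σ β, Real.rpow_mul dist_nonneg,
    ← Real.mul_rpow hC (Real.rpow_nonneg dist_nonneg _)]
  have := hg K hK hKD x hx y hy
  gcongr
  exact le_abs_self c

lemma exists_partialDeriv_bound {n : ℕ} {Ψ : E l → E n} (hσ : 0 ≤ σ) (hΨ : IsC1Holder σ Ψ)
    (hgb : ∀ i, Bounded (g i)) : ∃ B, 0 ≤ B ∧ ∀ m i x, |partialDeriv Ψ m i (hatMap g x)| ≤ B := by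
  obtain ⟨R, hR, hgR⟩ := exists_hatMap_bound hgb
  obtain ⟨B, hB, hBb⟩ := exists_fderiv_bound hσ hΨ hR
  refine ⟨B, hB, fun m i x => ?_⟩
  have := (fderiv ℝ (fun z => Ψ z m) (hatMap g x)).le_of_opNorm_le (hBb m _ (hgR x))
    (EuclideanSpace.single i 1)
  simpa [partialDeriv] using this

lemma jacobianMinor_eq (Ψ : E l → E 2) (i j : Fin l) (x : E l) : jacobianMinor Ψ i j x =
    partialDeriv Ψ 0 i x * partialDeriv Ψ 1 j x - partialDeriv Ψ 0 j x * partialDeriv Ψ 1 i x := by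
  rw [jacobianMinor, Matrix.det_fin_two_of]

/-- The partial derivatives along g are bounded and σβ-Hölder, hence α-Hölder as α ≤ σβ, and bounded
α-Hölder functions are stable under products. -/
lemma holderOnConvex_mul_jacobianMinor {Ψ : E l → E 2} (hσ : 0 ≤ σ) (hα : 0 ≤ α)
    (hασ : α ≤ σ * β) (hΨ : IsC1Holder σ Ψ) (hf : HolderOnConvex α D (hat f)) (hfb : Bounded f)
    (hg : ∀ i, HolderOnConvex β D (hat (g i))) (hgb : ∀ i, Bounded (g i)) (i j : Fin l) :
    HolderOnConvex α D (hat (f * comp (jacobianMinor Ψ i j) g)) := by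
  obtain ⟨B, hB, hBb⟩ := exists_partialDeriv_bound hσ hΨ hgb
  obtain ⟨M, hM, hMf⟩ := hfb.exists_hat_le
  have hq : ∀ m i, HolderOnConvex α D fun x => partialDeriv Ψ m i (hatMap g x) := fun m i =>
    (holderOnConvex_partialDeriv hσ hΨ hg m i).of_le (fun x _ => hBb m i x) hα hασ
  have hJ := ((hq 0 i).mul (hq 1 j) hB hB (hBb 0 i) (hBb 1 j)).sub
    ((hq 0 j).mul (hq 1 i) hB hB (hBb 0 j) (hBb 1 i))
  refine (hf.mul hJ hM (by positivity : 0 ≤ B * B + B * B) hMf fun x => ?_).congr fun x hx => ?_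
  · have h : ∀ a b : ℝ, |a| ≤ B → |b| ≤ B → |a * b| ≤ B * B := fun a b ha hb => by
      rw [abs_mul]
      exact mul_le_mul ha hb (abs_nonneg _) hB
    exact (abs_sub _ _).trans
      (add_le_add (h _ _ (hBb 0 i x) (hBb 1 j x)) (h _ _ (hBb 0 j x) (hBb 1 i x)))
  · rw [hat_mul, Pi.mul_apply, hat_comp _ g hx, jacobianMinor_eq]
    rfl

/-- The infinitesimal chain rule: `bdry_young_linearize` with Fᵢ = gⁱ and coefficients the partial
derivatives of Ψ at the image of the first vertex. The remainder constant ε is a multiple of the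
perimeter to the power σβ. -/
lemma exists_delta_young_comp_near {Ψ : E l → E 2} (hσ : 0 ≤ σ) (hβ : 1 / 2 < β)
    (hΨ : IsC1Holder σ Ψ) (hg : ∀ i, HolderOnConvex β D (hat (g i))) (hgb : ∀ i, Bounded (g i)) :
    ∃ C, 0 ≤ C ∧ ∀ S : Simp 2 D,
      |delta (youngGerm (comp (fun x => Ψ x 0) g) (comp (fun x => Ψ x 1) g)) S -
        ∑ i, ∑ j ∈ Finset.Ioi i,
          jacobianMinor Ψ i j (hatMap g (S.1 0)) * delta (youngGerm (g i) (g j)) S| ≤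
        C * perim S.tri ^ (σ * β + 2 * β) := by
  obtain ⟨Cg, hCg, hgC⟩ := exists_hatMap_holder hg
  obtain ⟨R, hR, hgR⟩ := exists_hatMap_bound hgb
  obtain ⟨B, hB, hBb⟩ := exists_fderiv_bound hσ hΨ hR
  obtain ⟨C, hC, hΨC⟩ := hΨ.exists_fderiv_holder
  obtain ⟨cH, hcH, hH⟩ := holderOnConvex_hat_comp hσ hΨ hg hgb 1
  have hY := youngConst_nonneg hβ
  refine ⟨2 * (1 + 3 * youngConst β) * (max cH (B * Cg) * (C * Cg ^ σ * Cg)), by positivity,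
    fun S => ?_⟩
  have hs := perim_nonneg S.tri
  have hK := S.convex_hull
  have hhull : ∀ x ∈ S.hull, dist x (S.1 0) ≤ perim S.tri := by
    intro x hx
    refine dist_le_perim_of_mem_convexHull (x := S.tri) (convexHull_mono ?_ hx)
    rintro _ ⟨i, rfl⟩
    fin_cases i <;> simp [Simp.tri]
  have hsum : ∀ m x, (∑ i, partialDeriv Ψ m i (hatMap g (S.1 0)) • hat (g i)) x =
      fderiv ℝ (fun z => Ψ z m) (hatMap g (S.1 0)) (hatMap g x) := by
    intro m x
    rw [sum_smul_apply_single, Finset.sum_apply]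
    exact Finset.sum_congr rfl fun i _ => mul_comm _ _
  have hlin : HolderBound (B * Cg) β
      (∑ i, partialDeriv Ψ 0 i (hatMap g (S.1 0)) • hat (g i)) S.hull := by
    intro x hx y hy
    rw [hsum, hsum, ← map_sub, mul_assoc, ← Real.norm_eq_abs]
    refine (ContinuousLinearMap.le_of_opNorm_le _ (hBb 0 _ (hgR _)) _).trans ?_
    exact mul_le_mul_of_nonneg_left (hgC _ hK S.hull_subset x hx y hy) hB
  have hrem : ∀ m, HolderBound (C * Cg ^ σ * Cg * perim S.tri ^ (σ * β)) β
      (hat (comp (fun x => Ψ x m) g) - ∑ i, partialDeriv Ψ m i (hatMap g (S.1 0)) • hat (g i))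
      S.hull := by
    intro m x hx y hy
    simp only [Pi.sub_apply]
    rw [hsum, hsum, hat_comp _ g (S.hull_subset hx), hat_comp _ g (S.hull_subset hy),
      ← Real.norm_eq_abs]
    set p := hatMap g (S.1 0) with hp
    -- The image of the triangle need not be convex, so the mean value inequality is applied on a
    -- ball of radius O(perimeter^β) containing it; there dΨ varies by O(perimeter^{σβ}).
    have hball : ∀ x ∈ S.hull,
        hatMap g x ∈ Metric.closedBall p (Cg * perim S.tri ^ β) := by
      intro x hx
      rw [Metric.mem_closedBall, dist_eq_norm]
      refine (hgC _ hK S.hull_subset x hx _ (S.mem_hull 0)).trans ?_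
      have := hhull x hx
      gcongr
    have hmv := Convex.norm_image_sub_le_of_norm_hasFDerivWithin_le
      (f := fun z => Ψ z m - fderiv ℝ (fun z => Ψ z m) p z)
      (f' := fun z => fderiv ℝ (fun z => Ψ z m) z - fderiv ℝ (fun z => Ψ z m) p)
      (C := C * (Cg * perim S.tri ^ β) ^ σ)
      (fun z _ => ((hΨ.differentiable m z).hasFDerivAt.sub
        (fderiv ℝ (fun z => Ψ z m) p).hasFDerivAt).hasFDerivWithinAt)
      (fun z hz => (hΨC m p z).trans (by
        rw [Metric.mem_closedBall, dist_eq_norm] at hz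
        gcongr)) (convex_closedBall p _) (hball y hy) (hball x hx)
    refine hmv.trans ?_
    have h1 := hgC _ hK S.hull_subset x hx y hy
    calc C * (Cg * perim S.tri ^ β) ^ σ * ‖hatMap g x - hatMap g y‖
        ≤ C * (Cg * perim S.tri ^ β) ^ σ * (Cg * dist x y ^ β) := by gcongr
      _ = _ := by
        rw [Real.mul_rpow hCg (by positivity), ← Real.rpow_mul hs, mul_comm β σ]
        ring
  have key := bdry_young_linearize (ε := C * Cg ^ σ * Cg * perim S.tri ^ (σ * β))
    (c := max cH (B * Cg)) hK hβ (fun i => (hg i).isHolder hK S.hull_subset)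
    (by positivity) (by positivity) (hlin.weaken (le_max_right _ _))
    ((hH _ hK S.hull_subset).weaken (le_max_left _ _)) (hrem 0) (hrem 1) S.inTri
  simp only [delta_youngGerm, jacobianMinor_eq]
  refine key.trans (le_of_eq ?_)
  rw [Real.rpow_add_of_nonneg hs (mul_nonneg hσ (by linarith)) (by linarith)]
  ring

/-- The sum of Züst germs sews the sum of its integrands, and the left-hand integrand differs from
that sum by O(diam^{σβ+2β}), a 2-Dini gauge because σβ + 2β ≥ α + 2β > 2. -/
lemma isSew_chainRule {Ψ : E l → E 2} (hα : 0 < α) (hα1 : α ≤ 1) (hβ : 1 / 2 < β) (hβ1 : β ≤ 1)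
    (hαβ : 2 < α + 2 * β) (hσ : 0 ≤ σ) (hασ : α ≤ σ * β) (hΨ : IsC1Holder σ Ψ)
    (hf : HolderOnConvex α D (hat f)) (hfb : Bounded f)
    (hg : ∀ i, HolderOnConvex β D (hat (g i))) (hgb : ∀ i, Bounded (g i)) :
    IsSew (cup f (delta (youngGerm (comp (fun x => Ψ x 0) g) (comp (fun x => Ψ x 1) g))))
      (∑ i, ∑ j ∈ Finset.Ioi i, zustGerm (f * comp (jacobianMinor Ψ i j) g) (g i) (g j)) := by
  obtain ⟨C, hC, hCb⟩ := exists_delta_young_comp_near hσ hβ hΨ hg hgb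
  obtain ⟨M, hM, hMf⟩ := hfb.exists_hat_le
  have hsew := IsSew.sum Finset.univ fun i _ => IsSew.sum (Finset.Ioi i) fun j _ =>
    isSew_zustGerm hα hα1 hβ hβ1 hαβ
      (holderOnConvex_mul_jacobianMinor hσ hα.le hασ hΨ hf hfb hg hgb i j) (hg i) (hg j)
  refine hsew.of_near (u := (M * C * 3 ^ (σ * β + 2 * β)) • fun S => S.diam ^ (σ * β + 2 * β))
    ((isDini_diam_rpow (by linarith) (by push_cast; linarith)).smul (by positivity)) fun S => ?_
  have e : (∑ i, ∑ j ∈ Finset.Ioi i,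
        cup (f * comp (jacobianMinor Ψ i j) g) (delta (youngGerm (g i) (g j)))) S =
      hat f (S.1 0) * ∑ i, ∑ j ∈ Finset.Ioi i,
        jacobianMinor Ψ i j (hatMap g (S.1 0)) * delta (youngGerm (g i) (g j)) S := by
    simp only [Finset.sum_apply, Finset.mul_sum]
    refine Finset.sum_congr rfl fun i _ => Finset.sum_congr rfl fun j _ => ?_
    rw [cup, apply_vertex (f * _), hat_mul, Pi.mul_apply, hat_comp _ g
      (S.hull_subset (S.mem_hull 0)), mul_assoc]
  rw [e, cup, apply_vertex f, ← mul_sub, abs_mul]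
  have hs := perim_nonneg S.tri
  calc _ ≤ M * (C * perim S.tri ^ (σ * β + 2 * β)) :=
        mul_le_mul (hMf _) (hCb S) (abs_nonneg _) hM
    _ ≤ M * (C * (3 * S.diam) ^ (σ * β + 2 * β)) := by
        have := S.perim_tri_le
        have : 0 ≤ σ * β + 2 * β := by linarith
        gcongr
    _ = _ := by
        rw [Real.mul_rpow (by norm_num) S.diam_nonneg]
        simp only [Pi.smul_apply, smul_eq_mul]
        ring

end ChainRule

end Germ

end RoughForm

end

/-! ### Normalization of the exponents and conclusion -/

theorem mainTheorem7 {d l : ℕ} (D : Set (RoughForm.E d)) (α β σ : ℝ)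
    (hα : 0 < α) (hβ : 0 < β) (hσ : 0 < σ) (hσ1 : σ ≤ 1)
    (hexp : 2 < min α (σ * β) + 2 * β)
    (f : RoughForm.Germ 0 D) (g : Fin l → RoughForm.Germ 0 D)
    (Ψ : RoughForm.E l → RoughForm.E 2)
    (hf : f.Holder α) (hg : ∀ i, (g i).Holder β)
    (hfb : f.Bounded) (hgb : ∀ i, (g i).Bounded)
    (hΨ : RoughForm.IsC1Holder σ Ψ) :
    RoughForm.Germ.WedgeIntegrable f
        (RoughForm.Germ.comp (fun x => Ψ x 0) g) (RoughForm.Germ.comp (fun x => Ψ x 1) g) ∧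
      (∀ i j : Fin l, i < j →
        RoughForm.Germ.WedgeIntegrable
          (f * RoughForm.Germ.comp (RoughForm.jacobianMinor Ψ i j) g) (g i) (g j)) ∧
      RoughForm.Germ.wedge f
          (RoughForm.Germ.comp (fun x => Ψ x 0) g) (RoughForm.Germ.comp (fun x => Ψ x 1) g) =
        ∑ i : Fin l, ∑ j ∈ Finset.Ioi i,
          RoughForm.Germ.wedge
            (f * RoughForm.Germ.comp (RoughForm.jacobianMinor Ψ i j) g) (g i) (g j) := by
  open RoughForm RoughForm.Germ in
  -- Extension and mollification need exponents at most 1. For β > 1 the value 1 is admissible,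
  -- because min(α, σ) + 2 > 2; boundedness of g permits the decrease.
  obtain ⟨β', hβ', hβ0, hβ1, hexp'⟩ : ∃ β', β' ≤ β ∧ 0 < β' ∧ β' ≤ 1 ∧
      2 < min α (σ * β') + 2 * β' := by
    rcases le_total β 1 with h | h
    · exact ⟨β, le_rfl, hβ, h, hexp⟩
    · refine ⟨1, h, one_pos, le_rfl, ?_⟩
      have : 0 < min α (σ * 1) := lt_min hα (by linarith)
      linarith
  -- The common Hölder exponent of f and of the products of f with the Jacobian minors.
  set α' := min α (σ * β') with hα'
  have hα0 : 0 < α' := lt_min hα (by positivity)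
  have hασ : α' ≤ σ * β' := min_le_right _ _
  have hσβ : σ * β' ≤ β' := mul_le_of_le_one_left hβ0.le hσ1
  have hα1 : α' ≤ 1 := by linarith
  -- From α' ≤ σβ' ≤ β' the hypothesis gives 3β' > 2, so the Young condition 2β' > 1 is automatic.
  have hβ2 : 1 / 2 < β' := by linarith
  obtain ⟨M, -, hM⟩ := hfb.exists_hat_le
  have hF := hf.holderOnConvex.of_le (fun x _ => hM x) hα0.le (min_le_left _ _ : α' ≤ α)
  have hG : ∀ i, HolderOnConvex β' D (hat (g i)) := fun i => by
    obtain ⟨N, -, hN⟩ := (hgb i).exists_hat_le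
    exact (hg i).holderOnConvex.of_le (fun x _ => hN x) hβ0.le hβ'
  have hH := holderOnConvex_hat_comp hσ.le hΨ hG hgb
  have hJ := holderOnConvex_mul_jacobianMinor hσ.le hα0.le hασ hΨ hF hfb hG hgb
  refine ⟨wedgeIntegrable_of_holder hα0 hα1 hβ2 hβ1 hexp' hF (hH 0) (hH 1), fun i j _ =>
    wedgeIntegrable_of_holder hα0 hα1 hβ2 hβ1 hexp' (hJ i j) (hG i) (hG j), ?_⟩
  rw [wedge, integ_eq_youngGerm hβ2 hβ1 (hH 0) (hH 1)]
  refine (isSew_chainRule hα0 hα1 hβ2 hβ1 hexp' hσ.le hασ hΨ hF hfb hG hgb).sew_two.trans ?_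
  exact Finset.sum_congr rfl fun i _ => Finset.sum_congr rfl fun j _ =>
    (wedge_eq_zustGerm hα0 hα1 hβ2 hβ1 hexp' (hJ i j) (hG i) (hG j)).symm
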